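/- **Conventions.** Let $\Lambda$ be a (linearly) ordered abelian group and $\mathrm{Aut}^+(\Lambda)$ its group of order-preserving group automorphisms. A $\Lambda$-tree is a non-empty geodesic $\Lambda$-metric space $(X,d)$ that is $0$-hyperbolic and whose Gromov products $(x\cdot y)_v=\frac12(d(x,v)+d(y,v)-d(x,y))$ all lie in $\Lambda$. An affine action of a group $G$ on $X$ is an action together with a homomorphism $\alpha:G\to\mathrm{Aut}^+(\Lambda)$ such that $d(gx,gy)=\alpha_g(d(x,y))$ for all $g\in G$, $x,y\in X$. Free actions are understood to be without inversions: no $g\ne1$ fixes a point, and no $g$ without fixed points has a square that fixes a point. A group is $\mathrm{ATF}(\Lambda)$ if it admits a free affine action on some $\Lambda$-tree. A subtree is a subset containing the segment between any two of its points; it is linear if any three of its points lie in a common segment. A line is a maximal linear subtree. A linear subtree embeds isometrically in $\Lambda$, uniquely up to translation and reflection, and so has two orientations. A subgroup $H$ stabilises a line $T$ if $hT=T$ for all $h\in H$; a line stabiliser is a subgroup of the form $\{g\in G: gT=T\}$ with $T$ a line. An element with $gT=T$ interchanges the ends of $T$ if $T$ has more than one point and $g$ reverses its orientation. $\mathbb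 Z^n$ carries the lexicographic order. For a subgroup-closed class $\mathcal P$ of groups, $G$ is $\mathrm{CS}\mathcal P$ if each $x\in G\setminus\{1\}$ lies in a unique maximal $\mathcal P$ subgroup of $G$, and each maximal $\mathcal P$ subgroup $M$ is malnormal, i.e. $M\cap gMg^{-1}=1$ for $g\in G\setminus M$. CSS and CSN are the cases of soluble and of nilpotent groups. **Proposition.** Let $G$ be a group with a free affine action on a $\Lambda$-tree $X$. 1. If $G$ has a non-trivial subnormal abelian subgroup, then $G$ stabilises a line of $X$. 2. If $\mathrm{Aut}^+(\Lambda)$ is soluble, then every subgroup of $G$ that stabilises a line of $X$ is soluble. 3. If $\Lambda=\mathbb Z^n$, then every subgroup of $G$ that stabilises a line of $X$ and preserves its orientation is nilpotent. 4. If $G\neq1$ and $\mathrm{Aut}^+(\Lambda)$ is soluble, then the non-trivial line stabilisers are precisely the maximal soluble subgroups of $G$. 5. If $G\neq1$, $\Lambda=\mathbb Z^n$ and there is no line of $X$ whose ends are interchanged by an element of $G$, then the non-trivial line stabilisers are precisely the maximal nilpotent subgroups of $G$. 6. If $\mathrm{Aut}^+(\Lambda)$ is soluble, then every $\mathrm{ATF}(\Lambda)$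 group is CSS. 7. If $\Lambda=\mathbb Z^n$ and no line of $X$ has its ends interchanged by an element of $G$, then $G$ is CSN. -/

import Mathlib

universe u v w

namespace AffineTree

section Trees

variable {Λ : Type u} [AddCommGroup Λ] [LinearOrder Λ] [IsOrderedAddMonoid Λ] {X : Type w}

/-- `Aut⁺(Λ)`: the group (under composition) of order-preserving group automorphisms of the
ordered abelian group `Λ`. -/
def AutPlus (Λ : Type u) [AddCommGroup Λ] [LinearOrder Λ] : Subgroup (Λ ≃o Λ) where
  carrier := {φ | ∀ a b, φ (a + b) = φ a + φ b}
  one_mem' := fun _ _ => rfl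
  mul_mem' := by
    intro φ ψ hφ hψ a b
    simp only [Set.mem_ofPred_eq] at hφ hψ
    simp only [RelIso.mul_apply, hψ, hφ]
  inv_mem' := by
    intro φ hφ a b
    simp only [Set.mem_ofPred_eq] at hφ
    apply φ.injective
    rw [hφ]
    simp only [RelIso.apply_inv_self]

/-- `d` is a `Λ`-metric on `X`. (Non-negativity follows from these axioms.) -/
structure IsLambdaMetric (d : X → X → Λ) : Prop where
  eq_zero_iff : ∀ x y, d x y = 0 ↔ x = y
  symm : ∀ x y, d x y = d y x
  triangle : ∀ x y z, d x z ≤ d x y + d y z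

/-- Twice the Gromov product, `2 (x · y)_v`. -/
def gromovTwice (d : X → X → Λ) (v x y : X) : Λ := d x v + d y v - d x y

/-- `(X, d)` is a (non-empty) `Λ`-tree: a geodesic `Λ`-metric space which is `0`-hyperbolic and
all of whose Gromov products `(x · y)_v` lie in `Λ`. -/
structure IsLambdaTree (d : X → X → Λ) : Prop extends IsLambdaMetric d where
  nonempty : Nonempty X
  geodesic : ∀ x y, ∃ γ : Λ → X, γ 0 = x ∧ γ (d x y) = y ∧
    ∀ s ∈ Set.Icc 0 (d x y), ∀ t ∈ Set.Icc 0 (d x y), d (γ s) (γ t) = |s - t|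
  gromov_mem : ∀ v x y, ∃ c, gromovTwice d v x y = c + c
  hyperbolic : ∀ v x y z,
    min (gromovTwice d v x z) (gromovTwice d v y z) ≤ gromovTwice d v x y

/-- The segment `[x, y]`. -/
def segment (d : X → X → Λ) (x y : X) : Set X := {z | d x z + d z y = d x y}

/-- Three points are collinear if some segment contains all of them. -/
def Collinear (d : X → X → Λ) (x y z : X) : Prop :=
  ∃ a b, x ∈ segment d a b ∧ y ∈ segment d a b ∧ z ∈ segment d a b

/-- A subtree of `X` is a subset containing the segment between any two of its points. -/
def IsSubtree (d : X → X → Λ) (T : Set X) : Prop := ∀ x ∈ T, ∀ y ∈ T, segment d x y ⊆ T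

/-- A linear subtree: any three of its points are collinear. -/
def IsLinearSubtree (d : X → X → Λ) (T : Set X) : Prop :=
  IsSubtree d T ∧ ∀ x ∈ T, ∀ y ∈ T, ∀ z ∈ T, Collinear d x y z

/-- A line is a maximal linear subtree. -/
def IsLine (d : X → X → Λ) (T : Set X) : Prop := Maximal (IsLinearSubtree d) T

/-- `f` restricts to an isometric embedding of `T` in `Λ`. A linear subtree has such a coordinate,
which is unique up to translations and the reflection of `Λ`. Its increasing and its decreasing
direction are the two orientations of `T`, and point to the two ends of `T`. -/
def IsCoordinate (d : X → X → Λ) (T : Set X) (f : X → Λ) : Prop :=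
  ∀ x ∈ T, ∀ y ∈ T, d x y = |f x - f y|

end Trees

section Actions

variable {Λ : Type u} [AddCommGroup Λ] [LinearOrder Λ] [IsOrderedAddMonoid Λ]
  {G : Type v} [Group G] {X : Type w} [MulAction G X]

open scoped Pointwise in
/-- The subgroup `{g | g T = T}` of `G`. -/
def setStab (G : Type v) [Group G] {X : Type w} [MulAction G X] (T : Set X) : Subgroup G :=
  MulAction.stabilizer G T

/-- `g` is an inversion: `g` has no fixed point but `g ^ 2` has one. -/
def IsInversion (X : Type w) [MulAction G X] (g : G) : Prop :=
  (∀ x : X, g • x ≠ x) ∧ ∃ x : X, g ^ 2 • x = x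

/-- The action of `G` on `(X, d)` is `α`-affine, free, and without inversions. -/
structure IsFreeAffineAction (d : X → X → Λ) (α : G →* AutPlus Λ) : Prop where
  affine : ∀ (g : G) (x y : X), d (g • x) (g • y) = (α g : Λ ≃o Λ) (d x y)
  free : ∀ g : G, g ≠ 1 → ∀ x : X, g • x ≠ x
  no_inversions : ∀ g : G, ¬ IsInversion X g

/-- `g` maps `T` onto itself, preserving the orientation. -/
def PreservesOrientation (d : X → X → Λ) (T : Set X) (g : G) : Prop :=
  g ∈ setStab G T ∧ ∃ f : X → Λ, IsCoordinate d T f ∧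
    ∀ x ∈ T, ∀ y ∈ T, f x ≤ f y → f (g • x) ≤ f (g • y)

/-- `g` interchanges the two ends of `T`: it maps `T`, which has more than one point, onto itself
and reverses the orientation. -/
def InterchangesEnds (d : X → X → Λ) (T : Set X) (g : G) : Prop :=
  T.Nontrivial ∧ g ∈ setStab G T ∧ ∃ f : X → Λ, IsCoordinate d T f ∧
    ∀ x ∈ T, ∀ y ∈ T, f x ≤ f y → f (g • y) ≤ f (g • x)

/-- `H` is a line stabiliser: the full stabiliser in `G` of some line. -/
def IsLineStabiliser (d : X → X → Λ) (H : Subgroup G) : Prop :=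
  ∃ T, IsLine d T ∧ H = setStab G T

/-- `H` stabilises a line. -/
def StabilisesLine (d : X → X → Λ) (H : Subgroup G) : Prop :=
  ∃ T, IsLine d T ∧ H ≤ setStab G T

/-- `G` is an `ATF(Λ)` group: it admits a free affine action without inversions on some
`Λ`-tree. -/
def IsATF (Λ : Type u) [AddCommGroup Λ] [LinearOrder Λ] [IsOrderedAddMonoid Λ]
    (G : Type v) [Group G] : Prop :=
  ∃ (X : Type w) (_ : MulAction G X) (d : X → X → Λ) (α : G →* AutPlus Λ),
    IsLambdaTree d ∧ IsFreeAffineAction d α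

end Actions

section Disconnected

variable (P : ∀ (K : Type v) [Group K], Prop)

/-- `M` is a maximal `P` subgroup of `G`. -/
def IsMaximalP {G : Type v} [Group G] (M : Subgroup G) : Prop :=
  Maximal (fun K : Subgroup G => P K) M

/-- `M` is malnormal in `G`: `M ∩ g M g⁻¹ = 1` for all `g ∉ M`. -/
def IsMalnormal {G : Type v} [Group G] (M : Subgroup G) : Prop :=
  ∀ g : G, g ∉ M → M ⊓ M.map (MulAut.conj g).toMonoidHom = ⊥

/-- `G` is `P`-disconnected: each non-trivial element lies in a unique maximal `P` subgroup. -/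
def IsPDisconnected (G : Type v) [Group G] : Prop :=
  ∀ x : G, x ≠ 1 → ∃! M : Subgroup G, IsMaximalP P M ∧ x ∈ M

/-- `G` is `CSP`: it is `P`-disconnected and its maximal `P` subgroups are malnormal. -/
def IsCSP (G : Type v) [Group G] : Prop :=
  IsPDisconnected P G ∧ ∀ M : Subgroup G, IsMaximalP P M → IsMalnormal M

end Disconnected

/-- The class of soluble groups. -/
def Soluble (K : Type v) [Group K] : Prop := Group.IsSolvable K

/-- The class of nilpotent groups. -/
def Nilpotent (K : Type v) [Group K] : Prop := Group.IsNilpotent K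

/-- `CSS` groups. -/
def IsCSS (G : Type v) [Group G] : Prop := IsCSP Soluble G

/-- `CSN` groups. -/
def IsCSN (G : Type v) [Group G] : Prop := IsCSP Nilpotent G

/-- `ℤⁿ` with the lexicographic order, the first coordinate being the most significant. -/
abbrev ZLex (n : ℕ) : Type := Lex (Fin n → ℤ)

end AffineTree

set_option linter.unusedSectionVars false

/-! Everything rests on one fact: a non-trivial g stabilises exactly one line. For uniqueness
(`line_unique`), two disjoint stable lines would be joined by a bridge whose foot g fixes. If two
distinct ones overlap, the intersection has an end point c, and c, gc, g²c would be three distinct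
end points of a linear set (`not_endpoint`). For existence, a median construction gives a non-empty
g-stable linear subtree (`exists_stable_linear`). A maximal g²-stable linear subtree containing it
is a line (`exists_line_sq`), and uniqueness for g² shows that g stabilises it too (`exists_line`).

Consequently k stabilises T as soon as some a ≠ 1 and its conjugate k⁻¹ak do
(`mem_setStab_of_conj`). So non-trivial abelian subgroups stabilise lines, and a stabilised line is
inherited by anything normalising the subgroup. This settles subnormal and soluble subgroups, and
also malnormality.

Conversely, a line stabiliser acts on a coordinate by maps v ↦ ±α_g(v) + b. Those with sign + and
trivial α_g are translations and commute, so the stabiliser is soluble when Aut⁺(Λ) is. For ℤⁿ,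
order automorphisms are unipotent along the convex subgroups, so the orientation-preserving affine
maps are unipotent on ℤ × ℤⁿ and form a nilpotent group. The claims on maximal subgroups are then
formal (`isLineStabiliser_iff`, `isCSP`). -/

namespace AffineTree

/-! ### Segments, medians and projections in Λ-trees -/

section TreeGeometry

variable {Λ : Type u} [AddCommGroup Λ] [LinearOrder Λ] [IsOrderedAddMonoid Λ] {X : Type w}
  {d : X → X → Λ}

theorem mem_segment {x y z : X} : z ∈ segment d x y ↔ d x z + d z y = d x y := Iff.rfl

namespace IsLambdaMetric

theorem self (h : IsLambdaMetric d) (x : X) : d x x = 0 := (h.eq_zero_iff x x).2 rfl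

theorem nonneg (h : IsLambdaMetric d) (x y : X) : 0 ≤ d x y := by
  have h1 := h.triangle x y x
  have h2 := h.symm x y
  have h3 := h.self x
  grind

theorem left_mem (h : IsLambdaMetric d) (x y : X) : x ∈ segment d x y := by
  simp [mem_segment, h.self]

theorem right_mem (h : IsLambdaMetric d) (x y : X) : y ∈ segment d x y := by
  simp [mem_segment, h.self]

theorem segment_symm (h : IsLambdaMetric d) {x y z : X} (hz : z ∈ segment d x y) :
    z ∈ segment d y x := by
  rw [mem_segment] at *
  rw [h.symm y z, h.symm z x, h.symm y x, add_comm, hz]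

/-- Two points each lying between the other and a third coincide. -/
theorem eq_of_mem_of_mem (h : IsLambdaMetric d) {x y z : X} (h1 : y ∈ segment d x z)
    (h2 : z ∈ segment d x y) : y = z := by
  rw [mem_segment] at *
  have h3 := h.symm z y
  exact (h.eq_zero_iff y z).1 (by grind)

/-- If `q` is on `[p, s]` and `r` is on `[q, s]`, then `r` is on `[p, s]`. -/
theorem mem_segment_trans (h : IsLambdaMetric d) {p q r s : X} (h1 : q ∈ segment d p s)
    (h2 : r ∈ segment d q s) : r ∈ segment d p s := by
  rw [mem_segment] at *
  have := h.triangle p q r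
  have := h.triangle p r s
  grind

theorem mem_segment_trans' (h : IsLambdaMetric d) {p q r s : X} (h1 : q ∈ segment d p s)
    (h2 : r ∈ segment d q s) : q ∈ segment d p r := by
  rw [mem_segment] at *
  have := h.triangle p q r
  have := h.triangle p r s
  grind

/-- A path from t to n through s runs over [m, s] twice, so it is a geodesic only if that segment is
degenerate. -/
theorem eq_of_median (h : IsLambdaMetric d) {m s t n : X} (h1 : m ∈ segment d s t)
    (h2 : m ∈ segment d s n) (h3 : s ∈ segment d t n) : m = s := by
  rw [mem_segment] at *
  have := h.symm t s
  have := h.symm t m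
  have := h.symm s m
  have := h.triangle t m n
  have := h.nonneg m s
  exact (h.eq_zero_iff m s).1 (by grind)

end IsLambdaMetric

namespace IsLambdaTree

/-- Hyperbolicity with the base point and the halves cleared away: a condition on distances alone,
suited to case analysis. -/
theorem four_point (h : IsLambdaTree d) (x y z v : X) :
    d x y + d z v ≤ max (d x z + d y v) (d y z + d x v) := by
  have := h.hyperbolic v x y z
  simp only [gromovTwice] at this
  grind

theorem dist_of_mem_segment (h : IsLambdaTree d) {x y u v : X} (hu : u ∈ segment d x y)
    (hv : v ∈ segment d x y) : d u v = |d x u - d x v| := by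
  rw [mem_segment] at *
  have h1 := h.four_point u v x y
  have h2 := h.triangle x u v
  have h3 := h.triangle x v u
  have h4 := h.symm u v
  have h5 := h.symm u x
  have h6 := h.symm v x
  have h7 := h.four_point x y u v
  grind

theorem mem_or_mem_of_mem (h : IsLambdaTree d) {x y u v : X} (hu : u ∈ segment d x y)
    (hv : v ∈ segment d x y) : u ∈ segment d x v ∨ v ∈ segment d x u := by
  have h1 := h.dist_of_mem_segment hu hv
  have h2 := h.symm u v
  simp only [mem_segment] at *
  grind

/-- If `u`, `v` lie on `[x, y]` with `u` closer to `x`, then `v` lies on `[u, y]`. -/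
theorem mem_segment_right (h : IsLambdaTree d) {x y u v : X} (hu : u ∈ segment d x v)
    (hv : v ∈ segment d x y) : v ∈ segment d u y :=
  h.segment_symm (h.mem_segment_trans' (h.segment_symm hv) (h.segment_symm hu))

theorem segment_subset (h : IsLambdaTree d) {x y u v : X} (hu : u ∈ segment d x y)
    (hv : v ∈ segment d x y) : segment d u v ⊆ segment d x y := by
  intro w hw
  have key : ∀ {u v : X}, u ∈ segment d x y → v ∈ segment d x y → w ∈ segment d u v →
      u ∈ segment d x v → w ∈ segment d x y := by
    intro u v hu hv hw huv
    exact h.segment_symm (h.mem_segment_trans (h.segment_symm hv)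
      (h.segment_symm (h.mem_segment_trans huv hw)))
  rcases h.mem_or_mem_of_mem hu hv with h1 | h1
  · exact key hu hv hw h1
  · exact key hv hu (h.segment_symm hw) h1

theorem isSubtree_segment (h : IsLambdaTree d) (x y : X) : IsSubtree d (segment d x y) :=
  fun _ hu _ hv => h.segment_subset hu hv

theorem segment_subset_left (h : IsLambdaTree d) {x y u : X} (hu : u ∈ segment d x y) :
    segment d x u ⊆ segment d x y := h.segment_subset (h.left_mem x y) hu

theorem segment_subset_right (h : IsLambdaTree d) {x y u : X} (hu : u ∈ segment d x y) :
    segment d u y ⊆ segment d x y := h.segment_subset hu (h.right_mem x y)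

/-- The three sides of a triangle have a common point. -/
theorem exists_median (h : IsLambdaTree d) (x y z : X) :
    ∃ c, c ∈ segment d x y ∧ c ∈ segment d x z ∧ c ∈ segment d y z := by
  -- The median is the point of [x, y] at distance (y · z)_x from x; this is where Gromov products
  -- must lie in Λ.
  obtain ⟨a, ha⟩ := h.gromov_mem x y z
  obtain ⟨γ, h0, h1, hγ⟩ := h.geodesic x y
  simp only [gromovTwice] at ha
  have t1 := h.triangle y x z
  have t2 := h.triangle x y z
  have s1 := h.symm y x
  have s2 := h.symm z x
  have s3 := h.symm y z
  have t3 := h.triangle x z y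
  have a0 : 0 ≤ a := by grind
  have a1 : a ≤ d x y := by grind
  have hxy := h.nonneg x y
  have e1 := hγ 0 ⟨le_rfl, hxy⟩ a ⟨a0, a1⟩
  have e2 := hγ a ⟨a0, a1⟩ (d x y) ⟨hxy, le_rfl⟩
  rw [h0] at e1
  rw [h1] at e2
  have f1 := h.four_point (γ a) z x y
  have f2 := h.triangle x (γ a) z
  have f3 := h.symm (γ a) x
  have f4 := h.symm (γ a) y
  refine ⟨γ a, ?_, ?_, ?_⟩ <;> rw [mem_segment] <;> grind

/-- Overlapping segments concatenate. -/
theorem mem_segment_concat (h : IsLambdaTree d) {p q r s : X} (h1 : q ∈ segment d p r)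
    (h2 : r ∈ segment d q s) (hne : q ≠ r) : r ∈ segment d p s := by
  have h3 := h.four_point p r q s
  have h4 := h.symm r q
  have h5 := h.triangle p q s
  have h6 := h.nonneg q r
  have h7 : d q r ≠ 0 := fun h' => hne ((h.eq_zero_iff _ _).1 h')
  have h8 := h.triangle p r s
  rw [mem_segment] at *
  grind

theorem collinear_iff (h : IsLambdaTree d) {x y z : X} :
    Collinear d x y z ↔ x ∈ segment d y z ∨ y ∈ segment d x z ∨ z ∈ segment d x y := by
  constructor
  · rintro ⟨a, b, hx, hy, hz⟩
    have h1 := h.dist_of_mem_segment hx hy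
    have h2 := h.dist_of_mem_segment hx hz
    have h3 := h.dist_of_mem_segment hy hz
    have h4 := h.symm y x
    have h5 := h.symm z y
    simp only [mem_segment]
    grind
  · rintro (h1 | h1 | h1)
    · exact ⟨y, z, h1, h.left_mem _ _, h.right_mem _ _⟩
    · exact ⟨x, z, h.left_mem _ _, h1, h.right_mem _ _⟩
    · exact ⟨x, y, h.left_mem _ _, h.right_mem _ _, h1⟩

theorem isLinearSubtree_segment (h : IsLambdaTree d) (x y : X) :
    IsLinearSubtree d (segment d x y) :=
  ⟨h.isSubtree_segment x y, fun _ hu _ hv _ hw => ⟨x, y, hu, hv, hw⟩⟩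

end IsLambdaTree

theorem IsLinearSubtree.cases {T : Set X} (hT : IsLinearSubtree d T) (h : IsLambdaTree d)
    {x y z : X} (hx : x ∈ T) (hy : y ∈ T) (hz : z ∈ T) :
    x ∈ segment d y z ∨ y ∈ segment d x z ∨ z ∈ segment d x y :=
  h.collinear_iff.1 (hT.2 x hx y hy z hz)

theorem IsLinearSubtree.mono {T S : Set X} (hT : IsLinearSubtree d T) (hS : IsSubtree d S)
    (hST : S ⊆ T) : IsLinearSubtree d S :=
  ⟨hS, fun x hx y hy z hz => hT.2 x (hST hx) y (hST hy) z (hST hz)⟩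

theorem IsSubtree.inter {T S : Set X} (hT : IsSubtree d T) (hS : IsSubtree d S) :
    IsSubtree d (T ∩ S) :=
  fun x hx y hy => Set.subset_inter (hT x hx.1 y hy.1) (hS x hx.2 y hy.2)

theorem isLinearSubtree_sUnion {C : Set (Set X)} (hC : DirectedOn (· ⊆ ·) C)
    (hlin : ∀ T ∈ C, IsLinearSubtree d T) : IsLinearSubtree d (⋃₀ C) := by
  constructor
  · rintro x ⟨S, hS, hx⟩ y ⟨T, hT, hy⟩
    obtain ⟨R, hR, hSR, hTR⟩ := hC S hS T hT
    exact ((hlin R hR).1 x (hSR hx) y (hTR hy)).trans (Set.subset_sUnion_of_mem hR)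
  · rintro x ⟨S, hS, hx⟩ y ⟨T, hT, hy⟩ z ⟨U, hU, hz⟩
    obtain ⟨R, hR, hSR, hTR⟩ := hC S hS T hT
    obtain ⟨Q, hQ, hRQ, hUQ⟩ := hC R hR U hU
    exact (hlin Q hQ).2 x (hRQ (hSR hx)) y (hRQ (hTR hy)) z (hUQ hz)

/-- A projection of a point of `T` to a line is an end point of the intersection. -/
theorem IsLinearSubtree.eq_of_projection (h : IsLambdaTree d) {T S : Set X}
    (hT : IsLinearSubtree d T) (hST : S ⊆ T) {x c : X} (hx : x ∈ T) (hxc : x ≠ c)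
    (hproj : ∀ s ∈ S, c ∈ segment d x s) :
    ∀ s ∈ S, ∀ t ∈ S, c ∈ segment d s t → c = s ∨ c = t := by
  intro s hs t ht hst
  have h1 := hproj s hs
  have h2 := hproj t ht
  -- The point c is the median of x, s, t, which are collinear in T, so it equals the middle one of
  -- the three; this is not x.
  rcases hT.cases h hx (hST hs) (hST ht) with h3 | h3 | h3
  · exact absurd (h.eq_of_median h1 h2 h3).symm hxc
  · exact Or.inl (h.eq_of_median (h.segment_symm h1) hst h3)
  · exact Or.inr (h.eq_of_median (h.segment_symm h2) (h.segment_symm hst) h3)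

/-- The hull of a subtree and a point. -/
def coneHull (d : X → X → Λ) (T : Set X) (y : X) : Set X := {u | ∃ s ∈ T, u ∈ segment d s y}

theorem subset_coneHull (h : IsLambdaTree d) (T : Set X) (y : X) : T ⊆ coneHull d T y :=
  fun s hs => ⟨s, hs, h.left_mem s y⟩

theorem mem_coneHull (h : IsLambdaTree d) {T : Set X} (hT : T.Nonempty) (y : X) :
    y ∈ coneHull d T y := by
  obtain ⟨s, hs⟩ := hT
  exact ⟨s, hs, h.right_mem s y⟩

theorem IsSubtree.coneHull (h : IsLambdaTree d) {T : Set X} (hT : IsSubtree d T) (y : X) :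
    IsSubtree d (coneHull d T y) := by
  rintro u ⟨s, hs, hu⟩ v ⟨t, ht, hv⟩ w hw
  obtain ⟨c, hc1, hc2, hc3⟩ := h.exists_median s t y
  have hcT : c ∈ T := hT s hs t ht hc1
  obtain ⟨e, he1, he2, he3⟩ := h.exists_median u v y
  -- `[u, v]` is covered by `[u, e]` and `[e, v]`
  have hwe : w ∈ segment d u e ∨ w ∈ segment d v e := by
    rcases h.mem_or_mem_of_mem hw he1 with h1 | h1
    · exact Or.inl h1
    · exact Or.inr (h.segment_symm (h.mem_segment_right h1 hw))
  rcases hwe with h1 | h1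
  · exact ⟨s, hs, h.segment_subset_right hu (h.segment_subset_left he2 h1)⟩
  · exact ⟨t, ht, h.segment_subset_right hv (h.segment_subset_left he3 h1)⟩

theorem isLine_nonempty (h : IsLambdaTree d) {T : Set X} (hT : IsLine d T) : T.Nonempty := by
  obtain ⟨x⟩ := h.nonempty
  by_contra hne
  rw [Set.not_nonempty_iff_eq_empty] at hne
  subst hne
  exact hT.2 (h.isLinearSubtree_segment x x) (Set.empty_subset _) (h.left_mem x x)

/-- Lines are closed: every point projects to a line. -/
theorem IsLine.exists_projection (h : IsLambdaTree d) {T : Set X} (hT : IsLine d T) (y : X) :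
    ∃ c ∈ T, ∀ s ∈ T, c ∈ segment d y s := by
  by_contra! hno
  have hne := isLine_nonempty h hT
  -- Without a projection, T runs towards y with no last point. The median m of s, t, y is then
  -- passed by some n in T nearer to y, and linearity of s, t, n forces m = s or m = t. The nested
  -- segments [s, y] have a linear union containing T and y, so maximality puts y in T, where it is
  -- its own projection.
  have hchain : ∀ s ∈ T, ∀ t ∈ T, s ∈ segment d t y ∨ t ∈ segment d s y := by
    intro s hs t ht
    obtain ⟨m, hm1, hm2, hm3⟩ := h.exists_median s t y
    have hmT := hT.1.1 s hs t ht hm1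
    obtain ⟨r, hr, hmr⟩ := hno m hmT
    obtain ⟨n, hn1, hn2, hn3⟩ := h.exists_median m r y
    have hnT := hT.1.1 m hmT r hr hn1
    have hnm : n ≠ m := by
      rintro rfl
      exact hmr (h.segment_symm hn3)
    have hsn : m ∈ segment d s n := h.mem_segment_trans' hm2 hn2
    have htn : m ∈ segment d t n := h.mem_segment_trans' hm3 hn2
    rcases hT.1.cases h hs ht hnT with h1 | h1 | h1
    · have := h.eq_of_median hm1 hsn h1
      exact Or.inl (this ▸ hm3)
    · have := h.eq_of_median (h.segment_symm hm1) htn h1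
      exact Or.inr (this ▸ hm2)
    · exact absurd (h.eq_of_median (h.segment_symm hsn) (h.segment_symm htn) h1).symm hnm
  have hlin : IsLinearSubtree d (⋃₀ ((fun s => segment d s y) '' T)) := by
    refine isLinearSubtree_sUnion ?_ ?_
    · rintro _ ⟨s, hs, rfl⟩ _ ⟨t, ht, rfl⟩
      rcases hchain s hs t ht with h1 | h1
      · exact ⟨_, ⟨t, ht, rfl⟩, h.segment_subset_right h1, Set.Subset.rfl⟩
      · exact ⟨_, ⟨s, hs, rfl⟩, Set.Subset.rfl, h.segment_subset_right h1⟩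
    · rintro _ ⟨s, hs, rfl⟩
      exact h.isLinearSubtree_segment s y
  have hy : y ∈ T := by
    obtain ⟨s, hs⟩ := hne
    exact hT.2 hlin (fun t ht => ⟨_, ⟨t, ht, rfl⟩, h.left_mem t y⟩)
      ⟨_, ⟨s, hs, rfl⟩, h.right_mem s y⟩
  obtain ⟨s, hs, hys⟩ := hno y hy
  exact hys (h.left_mem y s)

end TreeGeometry

/-! ### Coordinates on linear subtrees -/

section Coordinates

variable {Λ : Type u} [AddCommGroup Λ] [LinearOrder Λ] [IsOrderedAddMonoid Λ] {X : Type w}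
  {d : X → X → Λ}

/-- Two coordinates of the same set agree up to translation and reflection. -/
theorem sub_eq_or_sub_eq_of_abs {T : Set X} {f f' : X → Λ}
    (hff : ∀ x ∈ T, ∀ y ∈ T, |f x - f y| = |f' x - f' y|) :
    (∀ x ∈ T, ∀ y ∈ T, f x - f y = f' x - f' y) ∨
      ∀ x ∈ T, ∀ y ∈ T, f x - f y = f' y - f' x := by
  by_contra! hno
  obtain ⟨⟨a, ha, b, hb, hab⟩, p, hp, q, hq, hpq⟩ := hno
  have h1 := hff a ha b hb
  have h2 := hff a ha p hp
  have h3 := hff a ha q hq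
  have h4 := hff b hb p hp
  have h5 := hff b hb q hq
  have h6 := hff p hp q hq
  rw [abs_eq_abs] at h1 h2 h3 h4 h5 h6
  grind

theorem IsCoordinate.sub_eq_or {T : Set X} {f f' : X → Λ} (hf : IsCoordinate d T f)
    (hf' : IsCoordinate d T f') :
    (∀ x ∈ T, ∀ y ∈ T, f x - f y = f' x - f' y) ∨
      ∀ x ∈ T, ∀ y ∈ T, f x - f y = f' y - f' x :=
  sub_eq_or_sub_eq_of_abs fun x hx y hy => by rw [← hf x hx y hy, ← hf' x hx y hy]

theorem IsLinearSubtree.exists_isCoordinate (h : IsLambdaTree d) {T : Set X}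
    (hT : IsLinearSubtree d T) : ∃ f, IsCoordinate d T f := by
  classical
  rcases T.subsingleton_or_nontrivial with hs | ⟨a, ha, b, hb, hab⟩
  · refine ⟨fun _ => 0, fun x hx y hy => ?_⟩
    rw [hs hx hy, h.self]
    simp
  -- Signed distance from a, with b on the positive side.
  · refine ⟨fun x => if a ∈ segment d x b then -d a x else d a x, fun x hx y hy => ?_⟩
    have h0 : d a b ≠ 0 := fun h' => hab ((h.eq_zero_iff _ _).1 h')
    have n0 := h.nonneg a b
    have n1 := h.nonneg a x
    have n2 := h.nonneg a y
    have n3 := h.nonneg b x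
    have n4 := h.nonneg b y
    have n5 := h.nonneg x y
    have c1 := hT.cases h ha hb hx
    have c2 := hT.cases h ha hb hy
    have c3 := hT.cases h ha hx hy
    have c4 := hT.cases h hb hx hy
    have s1 := h.symm x a
    have s2 := h.symm y a
    have s3 := h.symm x b
    have s4 := h.symm y b
    have s5 := h.symm b a
    have s6 := h.symm y x
    have f1 := h.four_point a b x y
    have f2 := h.four_point a x b y
    have f3 := h.four_point a y b x
    simp only [mem_segment] at *
    split_ifs with i1 i2 i2
    all_goals
      rcases c3 with c3 | c3 | c3 <;> rcases c4 with c4 | c4 | c4 <;> grind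

end Coordinates

/-! ### Uniqueness of the stable line -/

section Actions

open scoped Pointwise

variable {Λ : Type u} [AddCommGroup Λ] [LinearOrder Λ] [IsOrderedAddMonoid Λ]
  {G : Type v} [Group G] {X : Type w} [MulAction G X] {d : X → X → Λ} {α : G →* AutPlus Λ}

namespace AutPlus

theorem map_add (φ : AutPlus Λ) (a b : Λ) : (φ : Λ ≃o Λ) (a + b) = (φ : Λ ≃o Λ) a + φ.1 b :=
  φ.2 a b

/-- An order-preserving automorphism as an additive map. -/
def toAddMonoidHom (φ : AutPlus Λ) : Λ →+ Λ :=
  AddMonoidHom.mk' (φ : Λ ≃o Λ) φ.2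

theorem map_zero (φ : AutPlus Λ) : (φ : Λ ≃o Λ) 0 = 0 := _root_.map_zero (toAddMonoidHom φ)

theorem map_sub (φ : AutPlus Λ) (a b : Λ) : (φ : Λ ≃o Λ) (a - b) = (φ : Λ ≃o Λ) a - φ.1 b :=
  _root_.map_sub (toAddMonoidHom φ) a b

theorem map_neg (φ : AutPlus Λ) (a : Λ) : (φ : Λ ≃o Λ) (-a) = -(φ : Λ ≃o Λ) a :=
  _root_.map_neg (toAddMonoidHom φ) a

theorem map_abs (φ : AutPlus Λ) (a : Λ) : (φ : Λ ≃o Λ) |a| = |(φ : Λ ≃o Λ) a| := by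
  rcases le_total 0 a with h | h
  · have : 0 ≤ (φ : Λ ≃o Λ) a := by
      rw [← map_zero φ]
      exact φ.1.monotone h
    rw [abs_of_nonneg h, abs_of_nonneg this]
  · have : (φ : Λ ≃o Λ) a ≤ 0 := by
      rw [← map_zero φ]
      exact φ.1.monotone h
    rw [abs_of_nonpos h, abs_of_nonpos this, map_neg]

theorem map_pos (φ : AutPlus Λ) {a : Λ} (ha : 0 < a) : 0 < (φ : Λ ≃o Λ) a := by
  rw [← map_zero φ]
  exact φ.1.strictMono ha

end AutPlus

namespace IsFreeAffineAction

theorem smul_mem_segment (hA : IsFreeAffineAction d α) (g : G) {x y z : X}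
    (hz : z ∈ segment d x y) : g • z ∈ segment d (g • x) (g • y) := by
  rw [mem_segment] at *
  rw [hA.affine, hA.affine, hA.affine, ← hz, AutPlus.map_add]

theorem smul_mem_segment_iff (hA : IsFreeAffineAction d α) (g : G) {x y z : X} :
    g • z ∈ segment d (g • x) (g • y) ↔ z ∈ segment d x y := by
  refine ⟨fun hz => ?_, hA.smul_mem_segment g⟩
  simpa using hA.smul_mem_segment g⁻¹ hz

theorem isSubtree_smul (hA : IsFreeAffineAction d α) (g : G) {T : Set X} (hT : IsSubtree d T) :
    IsSubtree d (g • T) := by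
  intro x hx y hy z hz
  rw [Set.mem_smul_set_iff_inv_smul_mem] at *
  exact hT _ hx _ hy (hA.smul_mem_segment g⁻¹ hz)

theorem isLinearSubtree_smul (hA : IsFreeAffineAction d α) (g : G) {T : Set X}
    (hT : IsLinearSubtree d T) : IsLinearSubtree d (g • T) := by
  refine ⟨hA.isSubtree_smul g hT.1, fun x hx y hy z hz => ?_⟩
  rw [Set.mem_smul_set_iff_inv_smul_mem] at *
  obtain ⟨a, b, h1, h2, h3⟩ := hT.2 _ hx _ hy _ hz
  exact ⟨g • a, g • b, by simpa using hA.smul_mem_segment g h1,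
    by simpa using hA.smul_mem_segment g h2, by simpa using hA.smul_mem_segment g h3⟩

theorem isLine_smul (hA : IsFreeAffineAction d α) (g : G) {T : Set X} (hT : IsLine d T) :
    IsLine d (g • T) := by
  refine ⟨hA.isLinearSubtree_smul g hT.1, fun S hS hTS => ?_⟩
  have h1 := hT.2 (hA.isLinearSubtree_smul g⁻¹ hS) (Set.subset_smul_set_iff.2 (by simpa using hTS))
  exact Set.subset_smul_set_iff.2 h1

theorem eq_one_of_smul_eq (hA : IsFreeAffineAction d α) {g : G} {x : X} (h : g • x = x) :
    g = 1 := by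
  by_contra hne
  exact hA.free g hne x h

/-- An involution would be an inversion: it has no fixed point, while its square fixes every point.
-/
theorem sq_ne_one (hA : IsFreeAffineAction d α) (h : IsLambdaTree d) {g : G} (hg : g ≠ 1) :
    g ^ 2 ≠ 1 := by
  intro h2
  obtain ⟨x⟩ := h.nonempty
  exact hA.no_inversions g ⟨hA.free g hg, x, by rw [h2, one_smul]⟩

/-- In a coordinate, `g` is increasing or decreasing on a set that it maps into itself. -/
theorem sub_eq_or_of_mapsTo (hA : IsFreeAffineAction d α) {T : Set X} {f : X → Λ}
    (hf : IsCoordinate d T f) {g : G} (hg : ∀ x ∈ T, g • x ∈ T) :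
    (∀ x ∈ T, ∀ y ∈ T, f (g • x) - f (g • y) = (α g : Λ ≃o Λ) (f x - f y)) ∨
      ∀ x ∈ T, ∀ y ∈ T, f (g • x) - f (g • y) = (α g : Λ ≃o Λ) (f y - f x) := by
  have := sub_eq_or_sub_eq_of_abs (T := T) (f := fun x => f (g • x))
    (f' := fun x => (α g : Λ ≃o Λ) (f x)) (fun x hx y hy => by
      rw [← AutPlus.map_sub, ← AutPlus.map_abs, ← hf x hx y hy, ← hA.affine,
        hf _ (hg x hx) _ (hg y hy)])
  simpa only [AutPlus.map_sub] using this

/-- A non-trivial element stabilising a linear subtree fixes no end point of it. -/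
theorem not_endpoint (hA : IsFreeAffineAction d α) (h : IsLambdaTree d) {g : G} (hg : g ≠ 1)
    {L : Set X} (hL : IsLinearSubtree d L) (hgL : g • L = L) {c : X} (hc : c ∈ L)
    (hend : ∀ s ∈ L, ∀ t ∈ L, c ∈ segment d s t → c = s ∨ c = t) : False := by
  have hmem : ∀ {x}, x ∈ L → g • x ∈ L := fun hx => hgL ▸ Set.smul_mem_smul_set hx
  have hmem' : ∀ {x}, x ∈ L → g⁻¹ • x ∈ L := fun hx => by
    rw [← Set.mem_smul_set_iff_inv_smul_mem, hgL]
    exact hx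
  have hstep : ∀ {c : X}, (∀ s ∈ L, ∀ t ∈ L, c ∈ segment d s t → c = s ∨ c = t) →
      ∀ s ∈ L, ∀ t ∈ L, g • c ∈ segment d s t → g • c = s ∨ g • c = t := by
    intro c hc s hs t ht hst
    have := hc _ (hmem' hs) _ (hmem' ht) (by simpa using hA.smul_mem_segment g⁻¹ hst)
    simpa only [eq_inv_smul_iff] using this
  have n1 : ∀ x : X, g • x ≠ x := hA.free g hg
  have n2 : g • g • c ≠ c := by
    rw [smul_smul, ← sq]
    exact hA.free _ (hA.sq_ne_one h hg) c
  have c1 := hmem hc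
  have c2 := hmem c1
  -- The points c, gc, g²c are distinct end points of L, yet one of them must lie between the other
  -- two.
  rcases hL.cases h hc c1 c2 with h1 | h1 | h1
  · rcases hend _ c1 _ c2 h1 with h2 | h2
    · exact n1 c h2.symm
    · exact n2 h2.symm
  · rcases hstep hend _ hc _ c2 h1 with h2 | h2
    · exact n1 c h2
    · exact n1 _ h2.symm
  · rcases hstep (hstep hend) _ hc _ c1 h1 with h2 | h2
    · exact n2 h2
    · exact n1 _ h2

/-- A non-trivial element stabilises at most one line. -/
theorem line_unique (hA : IsFreeAffineAction d α) (h : IsLambdaTree d) {g : G} (hg : g ≠ 1)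
    {T T' : Set X} (hT : IsLine d T) (hT' : IsLine d T') (hgT : g • T = T) (hgT' : g • T' = T') :
    T = T' := by
  by_contra hne
  have hsub : ¬ T ⊆ T' := fun hs => hne (hs.antisymm (hT.2 hT'.1 hs))
  obtain ⟨x, hx, hxT'⟩ := Set.not_subset.1 hsub
  rcases (T ∩ T').eq_empty_or_nonempty with hE | ⟨s0, hs0⟩
  · obtain ⟨y, hy⟩ := isLine_nonempty h hT'
    obtain ⟨c, hc, hproj⟩ := hT.exists_projection h y
    -- The foot c of the bridge serves every point of T', not only y. Translating by g, both c ∈ [y,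
    -- gc] and gc ∈ [y, c] hold, so g would fix c.
    have key : ∀ y' ∈ T', ∀ s ∈ T, c ∈ segment d y' s := by
      intro y' hy' s hs
      obtain ⟨m, m1, m2, m3⟩ := h.exists_median c y y'
      have hm := hT'.1.1 y hy y' hy' m3
      have hmc : c ≠ m := by
        rintro rfl
        exact Set.notMem_empty c (hE ▸ ⟨hc, hm⟩)
      have hcm : c ∈ segment d s m := h.mem_segment_trans' (h.segment_symm (hproj s hs)) m1
      exact h.segment_symm (h.segment_subset_left (h.mem_segment_concat hcm m2 hmc) hcm)
    have h1 : g • c ∈ T := by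
      rw [← hgT]
      exact Set.smul_mem_smul_set hc
    have h2 : g⁻¹ • y ∈ T' := by
      rw [← Set.mem_smul_set_iff_inv_smul_mem, hgT']
      exact hy
    have h3 : g⁻¹ • c ∈ T := by
      rw [← Set.mem_smul_set_iff_inv_smul_mem, hgT]
      exact hc
    have h4 : g • c ∈ segment d y c := by
      simpa using hA.smul_mem_segment g (key _ h2 _ h3)
    exact hA.free g hg c (h.eq_of_mem_of_mem h4 (key y hy _ h1))
  -- Here T leaves T' at c, so c is an end point of the g-stable set T ∩ T'.
  · obtain ⟨c, hc, hproj⟩ := hT'.exists_projection h x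
    have hcT : c ∈ T := hT.1.1 x hx s0 hs0.1 (hproj s0 hs0.2)
    have hxc : x ≠ c := by
      rintro rfl
      exact hxT' hc
    refine hA.not_endpoint h hg (hT.1.mono (hT.1.1.inter hT'.1.1) Set.inter_subset_left) ?_
      ⟨hcT, hc⟩ (hT.1.eq_of_projection h Set.inter_subset_left hx hxc fun s hs => hproj s hs.2)
    rw [Set.smul_set_inter, hgT, hgT']

end IsFreeAffineAction

end Actions

/-! ### Existence of a stable line -/

section Existence

open scoped Pointwise

variable {Λ : Type u} [AddCommGroup Λ] [LinearOrder Λ] [IsOrderedAddMonoid Λ]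
  {G : Type v} [Group G] {X : Type w} [MulAction G X] {d : X → X → Λ} {α : G →* AutPlus Λ}

theorem IsLinearSubtree.exists_isLine {U : Set X} (hU : IsLinearSubtree d U) :
    ∃ T, U ⊆ T ∧ IsLine d T := by
  refine zorn_subset_nonempty {T | IsLinearSubtree d T} ?_ U hU
  intro C hC hchain _
  exact ⟨⋃₀ C, isLinearSubtree_sUnion hchain.directedOn hC, fun s => Set.subset_sUnion_of_mem⟩

namespace IsFreeAffineAction

/-- A linear subtree that `g` maps into itself lies in a maximal such subtree, which is
`g`-stable. -/
theorem exists_maximal_stable (hA : IsFreeAffineAction d α) (g : G) {U : Set X}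
    (hU : IsLinearSubtree d U) (hgU : g • U ⊆ U) :
    ∃ M, U ⊆ M ∧ g • M = M ∧ IsLinearSubtree d M ∧
      ∀ N, IsLinearSubtree d N → g • N ⊆ N → M ⊆ N → N ⊆ M := by
  obtain ⟨M, hUM, hM⟩ := zorn_subset_nonempty {T | IsLinearSubtree d T ∧ g • T ⊆ T}
    (fun C hC hchain _ => ⟨⋃₀ C, ⟨isLinearSubtree_sUnion hchain.directedOn fun T hT => (hC hT).1,
      by
        rw [Set.smul_set_sUnion]
        exact Set.iUnion₂_subset fun T hT => (hC hT).2.trans (Set.subset_sUnion_of_mem hT)⟩,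
      fun s => Set.subset_sUnion_of_mem⟩) U ⟨hU, hgU⟩
  -- The set g⁻¹M competes in the same Zorn family and contains M, so maximality turns the inclusion
  -- gM ⊆ M into equality.
  have hsub : M ⊆ g⁻¹ • M := Set.subset_smul_set_iff.2 (by simpa using hM.1.2)
  have hsub' : g⁻¹ • M ⊆ M := hM.2
    ⟨hA.isLinearSubtree_smul g⁻¹ hM.1.1, by simpa using hsub⟩ hsub
  refine ⟨M, hUM, hM.1.2.antisymm ?_, hM.1.1, fun N hN hgN hMN => hM.2 ⟨hN, hgN⟩ hMN⟩
  exact Set.subset_smul_set_iff.2 hsub'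

/-- `exists_maximal_stable` for subtrees that grow or shrink under `g`. -/
theorem exists_stable (hA : IsFreeAffineAction d α) (g : G) {U : Set X}
    (hU : IsLinearSubtree d U) (hgU : g • U ⊆ U ∨ U ⊆ g • U) :
    ∃ M, U ⊆ M ∧ g • M = M ∧ IsLinearSubtree d M := by
  rcases hgU with hgU | hgU
  · obtain ⟨M, h1, h2, h3, -⟩ := hA.exists_maximal_stable g hU hgU
    exact ⟨M, h1, h2, h3⟩
  · obtain ⟨M, h1, h2, h3, -⟩ := hA.exists_maximal_stable g⁻¹ hU
      (Set.smul_set_subset_iff_subset_inv_smul_set.2 (by simpa using hgU))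
    exact ⟨M, h1, (inv_smul_eq_iff.1 h2).symm, h3⟩

/-- Every element stabilises a non-empty linear subtree. -/
theorem exists_stable_linear (hA : IsFreeAffineAction d α) (h : IsLambdaTree d) {g : G}
    (hg : g ≠ 1) : ∃ L : Set X, L.Nonempty ∧ g • L = L ∧ IsLinearSubtree d L := by
  suffices ∃ U : Set X, U.Nonempty ∧ IsLinearSubtree d U ∧ (g • U ⊆ U ∨ U ⊆ g • U) by
    obtain ⟨U, h1, h2, h3⟩ := this
    obtain ⟨M, h4, h5, h6⟩ := hA.exists_stable g h2 h3
    exact ⟨M, h1.mono h4, h5, h6⟩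
  obtain ⟨x⟩ := h.nonempty
  obtain ⟨p, p1, p2, p3⟩ := h.exists_median x (g • x) (g⁻¹ • x)
  have q1 : g • p ∈ segment d x (g • x) := by
    simpa using h.segment_symm (hA.smul_mem_segment g p2)
  -- Both p and gp lie on [x, gx], and their order decides the type of motion. If p comes first,
  -- then g⁻¹p, p, gp are aligned and the points gⁿp run along a ray that g maps into itself.
  rcases h.mem_or_mem_of_mem p1 q1 with hp | hp
  · have r1 : g • p ∈ segment d p (g • x) := h.mem_segment_right hp q1
    have r2 : g⁻¹ • p ∈ segment d (g⁻¹ • x) p := by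
      simpa using hA.smul_mem_segment g⁻¹ hp
    have r3 : p ∈ segment d (g⁻¹ • p) (g • x) := h.mem_segment_right r2 (h.segment_symm p3)
    have r4 : p ∈ segment d (g⁻¹ • p) (g • p) := h.mem_segment_trans' r3 r1
    have hstep : ∀ n : ℕ, g ^ n • p ∈ segment d p (g ^ (n + 1) • p) := by
      intro n
      induction n with
      | zero => simpa using h.left_mem p (g • p)
      | succ n ih =>
        refine h.mem_segment_concat ih ?_ ?_
        · have := hA.smul_mem_segment (g ^ (n + 1)) r4
          rwa [smul_smul, smul_smul, pow_succ, mul_inv_cancel_right, ← pow_succ,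
            ← pow_succ] at this
        · rw [pow_succ, mul_smul]
          intro he
          exact hA.free g hg p (MulAction.injective _ he).symm
    have hmono : Monotone fun n : ℕ => segment d p (g ^ n • p) :=
      monotone_nat_of_le_succ fun n => h.segment_subset_left (hstep n)
    refine ⟨⋃₀ Set.range fun n : ℕ => segment d p (g ^ n • p), ⟨p, _, ⟨0, rfl⟩, h.left_mem _ _⟩,
      isLinearSubtree_sUnion ?_ ?_, Or.inl ?_⟩
    · exact directedOn_range.2 hmono.directed_le
    · rintro _ ⟨n, rfl⟩
      exact h.isLinearSubtree_segment _ _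
    · rintro _ ⟨z, ⟨_, ⟨n, rfl⟩, hz⟩, rfl⟩
      refine ⟨_, ⟨n + 1, rfl⟩, ?_⟩
      have h1 := hA.smul_mem_segment g hz
      rw [smul_smul, ← pow_succ'] at h1
      have h2 : g • p ∈ segment d p (g ^ (n + 1) • p) := by
        have := hmono (Nat.le_add_left 1 n) (h.right_mem _ _)
        rwa [pow_one] at this
      exact h.segment_subset_right h2 h1
  · have r1 : p ∈ segment d (g • p) (g • x) := h.mem_segment_right hp p1
    -- Here g flips [gp, p] onto [g²p, gp]. Both segments start at gp along [gp, gx], so one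
    -- contains the other; α_g may rescale lengths, so they need not be equal.
    have r2 : g • g • p ∈ segment d (g • p) (g • x) :=
      h.segment_symm (hA.smul_mem_segment g hp)
    have r3 : g • segment d (g • p) p = segment d (g • g • p) (g • p) := by
      ext z
      rw [Set.mem_smul_set_iff_inv_smul_mem, ← hA.smul_mem_segment_iff g, smul_inv_smul]
    have r4 : segment d (g • g • p) (g • p) = segment d (g • p) (g • g • p) :=
      Set.ext fun z => ⟨h.segment_symm, h.segment_symm⟩
    refine ⟨segment d (g • p) p, ⟨p, h.right_mem _ _⟩, h.isLinearSubtree_segment _ _, ?_⟩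
    rw [r3, r4]
    rcases h.mem_or_mem_of_mem r1 r2 with h1 | h1
    · exact Or.inr (h.segment_subset_left h1)
    · exact Or.inl (h.segment_subset_left h1)

/-- The square of an element stabilising a non-degenerate linear set preserves the orientation. -/
theorem sq_sub_eq (hA : IsFreeAffineAction d α) {T : Set X} {f : X → Λ}
    (hf : IsCoordinate d T f) {g : G} (hg : ∀ x ∈ T, g • x ∈ T) :
    ∀ x ∈ T, ∀ y ∈ T, f (g ^ 2 • x) - f (g ^ 2 • y) = (α (g ^ 2) : Λ ≃o Λ) (f x - f y) := by
  intro x hx y hy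
  have e : (α (g ^ 2) : Λ ≃o Λ) (f x - f y) = (α g : Λ ≃o Λ) ((α g : Λ ≃o Λ) (f x - f y)) := by
    rw [sq, map_mul]
    rfl
  rw [e, sq, mul_smul, mul_smul]
  rcases hA.sub_eq_or_of_mapsTo hf hg with h1 | h1
  · rw [h1 _ (hg x hx) _ (hg y hy), h1 x hx y hy]
  · rw [h1 _ (hg x hx) _ (hg y hy), h1 y hy x hx]

/-- The paths from ks and from s0 to c merge at a point of M. Since kc is outside M, it comes after
the merging point on [s0, c], so [ks, kc] is contained in [ks, c]. -/
theorem coneHull_smul_subset (hA : IsFreeAffineAction d α) (h : IsLambdaTree d) {k : G}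
    {M : Set X} (hM : IsSubtree d M) (hkM : k • M = M) {c s0 : X} (hs0 : s0 ∈ M)
    (hkc : k • c ∉ M) (hc : k • c ∈ segment d s0 c) :
    k • coneHull d M c ⊆ coneHull d M c := by
  rintro _ ⟨u, ⟨s, hs, hu⟩, rfl⟩
  have h1 := hA.smul_mem_segment k hu
  have hks : k • s ∈ M := hkM ▸ Set.smul_mem_smul_set hs
  refine ⟨k • s, hks, h.segment_subset_left ?_ h1⟩
  obtain ⟨m, m1, m2, m3⟩ := h.exists_median (k • s) s0 c
  have hm : m ∈ M := hM _ hks _ hs0 m1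
  rcases h.mem_or_mem_of_mem hc m3 with h2 | h2
  · exact absurd (hM _ hs0 _ hm h2) hkc
  · exact h.segment_subset_right m2 (h.mem_segment_right h2 hc)

/-- The square of a non-trivial element stabilises a line. -/
theorem exists_line_sq (hA : IsFreeAffineAction d α) (h : IsLambdaTree d) {g : G} (hg : g ≠ 1) :
    ∃ T, IsLine d T ∧ g ^ 2 • T = T := by
  obtain ⟨L, hLne, hgL, hL⟩ := hA.exists_stable_linear h hg
  have hk := hA.sq_ne_one h hg
  have hkL : g ^ 2 • L = L := by rw [sq, mul_smul, hgL, hgL]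
  obtain ⟨M, hLM, hkM, hM, hmax⟩ := hA.exists_maximal_stable (g ^ 2) hL hkL.subset
  have hgmem : ∀ x ∈ L, g • x ∈ L := fun x hx => hgL ▸ Set.smul_mem_smul_set hx
  generalize hkdef : g ^ 2 = k at *
  -- Maximality of M in usable form: an extension need only be comparable with its k-translate,
  -- since it then lies in a stable one.
  have hno : ∀ N, IsLinearSubtree d N → (k • N ⊆ N ∨ N ⊆ k • N) → M ⊆ N → N ⊆ M := by
    intro N hN hkN hMN
    obtain ⟨N', h1, h2, h3⟩ := hA.exists_stable k hN hkN
    exact h1.trans (hmax N' h3 h2.subset (hMN.trans h1))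
  obtain ⟨T, hMT, hT⟩ := hM.exists_isLine
  suffices T ⊆ M by
    obtain rfl := this.antisymm hMT
    exact ⟨T, hT, hkM⟩
  intro x hx
  by_contra hxM
  have hkT := hA.isLine_smul k hT
  have hMkT : M ⊆ k • T := by
    rw [← hkM]
    exact Set.smul_set_mono hMT
  obtain ⟨c, hc, hproj⟩ := hkT.exists_projection h x
  obtain ⟨s0, hs0⟩ := hLne
  have hcT : c ∈ T := hT.1.1 x hx s0 (hMT (hLM hs0)) (hproj s0 (hMkT (hLM hs0)))
  by_cases hcM : c ∈ M
  · have hxc : x ≠ c := by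
      rintro rfl
      exact hxM hcM
    exact hA.not_endpoint h hk hM hkM hcM
      (hT.1.eq_of_projection h hMT hx hxc fun s hs => hproj s (hMkT hs))
  · have hkc : k • c ∉ M := by
      rw [← hkM, Set.smul_mem_smul_set_iff]
      exact hcM
    have hkcT : k • c ∈ k • T := Set.smul_mem_smul_set hcT
    have hcone : IsLinearSubtree d (coneHull d M c) :=
      hT.1.mono (hM.1.coneHull h c) (by
        rintro u ⟨s, hs, hu⟩
        exact hT.1.1 s (hMT hs) c hcT hu)
    have hnot : ¬ (k • coneHull d M c ⊆ coneHull d M c ∨ coneHull d M c ⊆ k • coneHull d M c) :=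
      fun h1 => hcM (hno _ hcone h1 (subset_coneHull h M c) (mem_coneHull h ⟨s0, hLM hs0⟩ c))
    -- Any other position of s, c, kc in the line kT makes the hull of M and c comparable with its
    -- translate, which `hnot` excludes. So c and kc lie on opposite sides of M.
    have hbetween : ∀ s ∈ M, s ∈ segment d c (k • c) := by
      intro s hs
      rcases hkT.1.cases h (hMkT hs) hc hkcT with h1 | h1 | h1
      · exact h1
      · refine absurd (Or.inr ?_) hnot
        have hkM' : k⁻¹ • M = M := by rw [inv_smul_eq_iff, hkM]
        have h2 : k⁻¹ • c ∈ segment d (k⁻¹ • s) c := by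
          simpa using hA.smul_mem_segment k⁻¹ h1
        have h3 : k⁻¹ • c ∉ M := by
          rwa [← Set.mem_smul_set_iff_inv_smul_mem, hkM]
        have h4 : k⁻¹ • s ∈ M := hkM' ▸ Set.smul_mem_smul_set hs
        have := hA.coneHull_smul_subset h hM.1 hkM' h4 h3 h2
        exact Set.subset_smul_set_iff.2 this
      · exact absurd (Or.inl (hA.coneHull_smul_subset h hM.1 hkM hs hkc h1)) hnot
    have hf : IsCoordinate d L (d c) := fun s hs t ht =>
      h.dist_of_mem_segment (hbetween s (hLM hs)) (hbetween t (hLM ht))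
    -- As a square, k preserves the orientation of L, but carrying c across to kc it reverses
    -- distances from c (`e2`). Applied to s0 and gs0, the two force gs0 = s0. This conflict is why
    -- the argument is run for g² first.
    have e1 := hA.sq_sub_eq hf hgmem _ (hgmem s0 hs0) _ hs0
    rw [hkdef] at e1
    have e2 : ∀ s ∈ L, d c (k • s) + (α k : Λ ≃o Λ) (d c s) = d c (k • c) := by
      intro s hs
      have h1 := hbetween (k • s) (hLM (hkL ▸ Set.smul_mem_smul_set hs))
      rw [mem_segment, h.symm (k • s), hA.affine] at h1
      exact h1
    have e3 := e2 _ (hgmem s0 hs0)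
    have e4 := e2 _ hs0
    rw [AutPlus.map_sub] at e1
    have e5 : (α k : Λ ≃o Λ) (d c (g • s0)) = (α k : Λ ≃o Λ) (d c s0) := by grind
    have e6 := hf _ (hgmem s0 hs0) _ hs0
    rw [(α k : Λ ≃o Λ).injective e5, sub_self, abs_zero] at e6
    exact hA.free g hg s0 ((h.eq_zero_iff _ _).1 e6)

/-- Every non-trivial element stabilises a line. -/
theorem exists_line (hA : IsFreeAffineAction d α) (h : IsLambdaTree d) {g : G} (hg : g ≠ 1) :
    ∃ T, IsLine d T ∧ g • T = T := by
  obtain ⟨T, hT, hgT⟩ := hA.exists_line_sq h hg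
  refine ⟨T, hT, (hA.line_unique h (hA.sq_ne_one h hg) hT (hA.isLine_smul g hT) hgT ?_).symm⟩
  rw [smul_smul, ← pow_succ, pow_succ', mul_smul, hgT]

end IsFreeAffineAction

end Existence

/-! ### Subgroups stabilising lines, and orientation -/

section Stabilisers

open scoped Pointwise commutatorElement

variable {Λ : Type u} [AddCommGroup Λ] [LinearOrder Λ] [IsOrderedAddMonoid Λ]
  {G : Type v} [Group G] {X : Type w} [MulAction G X] {d : X → X → Λ} {α : G →* AutPlus Λ}

theorem mem_setStab {T : Set X} {g : G} : g ∈ setStab G T ↔ g • T = T :=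
  MulAction.mem_stabilizer_iff

theorem smul_mem_of_mem_setStab {T : Set X} {g : G} (hg : g ∈ setStab G T) {x : X} (hx : x ∈ T) :
    g • x ∈ T := by
  rw [← mem_setStab.1 hg]
  exact Set.smul_mem_smul_set hx

namespace IsFreeAffineAction

theorem eq_of_mem_setStab (hA : IsFreeAffineAction d α) (h : IsLambdaTree d) {T T' : Set X}
    (hT : IsLine d T) (hT' : IsLine d T') {g : G} (hg : g ≠ 1) (hgT : g ∈ setStab G T)
    (hgT' : g ∈ setStab G T') : T = T' :=
  hA.line_unique h hg hT hT' (mem_setStab.1 hgT) (mem_setStab.1 hgT')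

/-- If `g` and `k⁻¹ g k` stabilise `T`, where `g ≠ 1`, then so does `k`. -/
theorem mem_setStab_of_conj (hA : IsFreeAffineAction d α) (h : IsLambdaTree d) {T : Set X}
    (hT : IsLine d T) {g k : G} (hg : g ≠ 1) (hgT : g ∈ setStab G T)
    (hconj : k⁻¹ * g * k ∈ setStab G T) : k ∈ setStab G T := by
  rw [mem_setStab] at *
  refine (hA.line_unique h hg hT (hA.isLine_smul k hT) hgT ?_).symm
  rw [mul_smul, mul_smul, inv_smul_eq_iff] at hconj
  exact hconj

/-- An element commuting with a ≠ 1 permutes the lines stabilised by a, and there is only one. -/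
theorem exists_line_of_comm (hA : IsFreeAffineAction d α) (h : IsLambdaTree d) {H : Subgroup G}
    (hH : H ≠ ⊥) (hcomm : ∀ a ∈ H, ∀ b ∈ H, a * b = b * a) : StabilisesLine d H := by
  obtain ⟨a, ha, ha1⟩ := H.bot_or_exists_ne_one.resolve_left hH
  obtain ⟨T, hT, haT⟩ := hA.exists_line h ha1
  refine ⟨T, hT, fun b hb => hA.mem_setStab_of_conj h hT ha1 haT ?_⟩
  rw [mul_assoc, hcomm a ha b hb, inv_mul_cancel_left]
  exact haT

theorem le_setStab_of_normalises (hA : IsFreeAffineAction d α) (h : IsLambdaTree d)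
    {H K : Subgroup G} (hH : H ≠ ⊥) (hnorm : ∀ a ∈ H, ∀ k ∈ K, k⁻¹ * a * k ∈ H)
    (hline : StabilisesLine d H) : StabilisesLine d K := by
  obtain ⟨T, hT, hHT⟩ := hline
  obtain ⟨a, ha, ha1⟩ := H.bot_or_exists_ne_one.resolve_left hH
  exact ⟨T, hT, fun k hk => hA.mem_setStab_of_conj h hT ha1 (hHT ha) (hHT (hnorm a ha k hk))⟩

theorem stabilisesLine_top_of_isSubnormal (hA : IsFreeAffineAction d α) (h : IsLambdaTree d)
    {H : Subgroup G} (hsub : H.IsSubnormal) (hH : H ≠ ⊥) (hline : StabilisesLine d H) :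
    StabilisesLine d (⊤ : Subgroup G) := by
  induction hsub with
  | top => exact hline
  | step H K hHK _ hnorm ih =>
    refine ih (fun hK => hH (le_bot_iff.1 (hK ▸ hHK)))
      (hA.le_setStab_of_normalises h hH (fun a ha k hk => ?_) hline)
    have := hnorm.conj_mem ⟨a, hHK ha⟩ (Subgroup.mem_subgroupOf.2 ha) ⟨k⁻¹, K.inv_mem hk⟩
    simpa [Subgroup.mem_subgroupOf] using this

/-- The last non-trivial term of the derived series is abelian and normalised by H, so its line is
stabilised by H. -/
theorem stabilisesLine_of_soluble (hA : IsFreeAffineAction d α) (h : IsLambdaTree d)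
    {H : Subgroup G} (hH : H ≠ ⊥) (hsol : Group.IsSolvable H) : StabilisesLine d H := by
  classical
  obtain ⟨n, hn⟩ := (Group.isSolvable_def H).1 hsol
  have hex : ∃ n, derivedSeries H n = ⊥ := ⟨n, hn⟩
  have hpos : Nat.find hex ≠ 0 := by
    intro h0
    have := Nat.find_spec hex
    rw [h0, derivedSeries_zero] at this
    refine hH (H.eq_bot_iff_forall.2 fun x hx => ?_)
    have hx' : (⟨x, hx⟩ : H) ∈ (⊥ : Subgroup H) := this ▸ Subgroup.mem_top _
    exact congrArg Subtype.val (Subgroup.mem_bot.1 hx')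
  obtain ⟨m, hm⟩ := Nat.exists_eq_succ_of_ne_zero hpos
  have hbot := Nat.find_spec hex
  rw [hm, derivedSeries_succ] at hbot
  have hne : derivedSeries H m ≠ ⊥ := Nat.find_min hex (by omega)
  have hne' : (derivedSeries H m).map H.subtype ≠ ⊥ := fun h' =>
    hne ((Subgroup.map_eq_bot_iff_of_injective _ H.subtype_injective).1 h')
  refine hA.le_setStab_of_normalises h hne' ?_ (hA.exists_line_of_comm h hne' ?_)
  · rintro _ ⟨a, ha, rfl⟩ k hk
    have := (inferInstance : (derivedSeries H m).Normal).conj_mem a ha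
      ⟨k⁻¹, H.inv_mem hk⟩
    exact ⟨_, this, by simp⟩
  · rintro _ ⟨a, ha, rfl⟩ _ ⟨b, hb, rfl⟩
    have h1 : ⁅a, b⁆ = 1 := by
      rw [← Subgroup.mem_bot, ← hbot]
      exact Subgroup.commutator_mem_commutator ha hb
    rw [commutatorElement_eq_one_iff_mul_comm] at h1
    simpa using congrArg H.subtype h1

end IsFreeAffineAction

theorem map_units_smul (φ : AutPlus Λ) (ε : ℤˣ) (a : Λ) :
    (φ : Λ ≃o Λ) (ε • a) = ε • (φ : Λ ≃o Λ) a :=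
  _root_.map_zsmul (AutPlus.toAddMonoidHom φ) (ε : ℤ) a

/-- `g` acts on `T` with sign `ε` in the coordinate `f`. -/
def HasSign (f : X → Λ) (T : Set X) (α : G →* AutPlus Λ) (ε : ℤˣ) (g : G) : Prop :=
  ∀ x ∈ T, ∀ y ∈ T, f (g • x) - f (g • y) = ε • (α g : Λ ≃o Λ) (f x - f y)

theorem HasSign.mul {f : X → Λ} {T : Set X} {ε δ : ℤˣ} {g k : G} (hg : HasSign f T α ε g)
    (hk : HasSign f T α δ k) (hkT : k ∈ setStab G T) : HasSign f T α (ε * δ) (g * k) := by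
  intro x hx y hy
  rw [mul_smul, mul_smul, hg _ (smul_mem_of_mem_setStab hkT hx) _ (smul_mem_of_mem_setStab hkT hy),
    hk x hx y hy, map_units_smul, smul_smul, map_mul]
  rfl

theorem HasSign.inv {f : X → Λ} {T : Set X} {ε : ℤˣ} {g : G} (hg : HasSign f T α ε g)
    (hgT : g ∈ setStab G T) : HasSign f T α ε⁻¹ g⁻¹ := by
  intro x hx y hy
  have hmem := fun {z} (hz : z ∈ T) => smul_mem_of_mem_setStab ((setStab G T).inv_mem hgT) hz
  have := hg _ (hmem hx) _ (hmem hy)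
  rw [smul_inv_smul, smul_inv_smul] at this
  rw [this, map_units_smul, inv_smul_smul, map_inv]
  exact ((α g : Λ ≃o Λ).symm_apply_apply _).symm

/-- The elements of `G` that stabilise `T` and preserve its orientation, with respect to the
coordinate `f`. -/
def orientedStab (f : X → Λ) (T : Set X) (α : G →* AutPlus Λ) : Subgroup G where
  carrier := {g | g ∈ setStab G T ∧ HasSign f T α 1 g}
  one_mem' := ⟨one_mem _, fun x _ y _ => by
    rw [one_smul, one_smul, one_smul, map_one]
    rfl⟩
  mul_mem' := fun ha hb => ⟨mul_mem ha.1 hb.1, by simpa using ha.2.mul hb.2 hb.1⟩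
  inv_mem' := fun ha => ⟨inv_mem ha.1, by simpa using ha.2.inv ha.1⟩

theorem HasSign.one_apply {f : X → Λ} {T : Set X} {g : G} (hg : HasSign f T α 1 g) {x y : X}
    (hx : x ∈ T) (hy : y ∈ T) : f (g • x) - f (g • y) = (α g : Λ ≃o Λ) (f x - f y) := by
  rw [hg x hx y hy, one_smul]

namespace IsFreeAffineAction

theorem exists_hasSign (hA : IsFreeAffineAction d α) {T : Set X} {f : X → Λ}
    (hf : IsCoordinate d T f) {g : G} (hg : g ∈ setStab G T) : ∃ ε, HasSign f T α ε g := by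
  rcases hA.sub_eq_or_of_mapsTo hf (fun x hx => smul_mem_of_mem_setStab hg hx) with h1 | h1
  · exact ⟨1, fun x hx y hy => by rw [h1 x hx y hy, one_smul]⟩
  · refine ⟨-1, fun x hx y hy => ?_⟩
    rw [h1 x hx y hy, ← map_units_smul, Units.neg_smul, one_smul, neg_sub]

/-- Signs multiply in the commutative group ℤˣ, so they cancel in a commutator. -/
theorem commutator_mem_orientedStab (hA : IsFreeAffineAction d α) {T : Set X} {f : X → Λ}
    (hf : IsCoordinate d T f) {a b : G} (ha : a ∈ setStab G T) (hb : b ∈ setStab G T) :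
    a * b * a⁻¹ * b⁻¹ ∈ orientedStab f T α := by
  obtain ⟨ε, hε⟩ := hA.exists_hasSign hf ha
  obtain ⟨δ, hδ⟩ := hA.exists_hasSign hf hb
  have ha' := inv_mem ha
  have hb' := inv_mem hb
  refine ⟨mul_mem (mul_mem (mul_mem ha hb) ha') hb', ?_⟩
  have := ((hε.mul hδ hb).mul (hε.inv ha) ha').mul (hδ.inv hb) hb'
  rwa [mul_comm ε δ, mul_inv_cancel_right, mul_inv_cancel] at this

/-- In `orientedStab`, the elements acting on `Λ` trivially are translations, and commute. -/
theorem commute_of_map_eq_one (hA : IsFreeAffineAction d α) (h : IsLambdaTree d) {T : Set X}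
    (hne : T.Nonempty) {f : X → Λ} (hf : IsCoordinate d T f) {a b : G}
    (ha : a ∈ orientedStab f T α) (hb : b ∈ orientedStab f T α) (ha1 : α a = 1) (hb1 : α b = 1) :
    a * b = b * a := by
  obtain ⟨x, hx⟩ := hne
  have hax := smul_mem_of_mem_setStab ha.1 hx
  have hbx := smul_mem_of_mem_setStab hb.1 hx
  have h1 := ha.2.one_apply hbx hx
  have h2 := hb.2.one_apply hax hx
  rw [ha1] at h1
  rw [hb1] at h2
  change _ = f (b • x) - f x at h1
  change _ = f (a • x) - f x at h2
  have h3 := hf _ (smul_mem_of_mem_setStab ha.1 hbx) _ (smul_mem_of_mem_setStab hb.1 hax)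
  have h4 : f (a • b • x) - f (b • a • x) = 0 := by grind
  rw [h4, abs_zero, h.eq_zero_iff, smul_smul, smul_smul, ← inv_smul_eq_iff, smul_smul] at h3
  exact (inv_mul_eq_one.1 (hA.eq_one_of_smul_eq h3)).symm

/-- There are three layers: an abelian quotient recording orientation, the image of the oriented
part in Aut⁺(Λ), and an abelian kernel of translations. -/
theorem isSolvable_setStab (hA : IsFreeAffineAction d α) (h : IsLambdaTree d)
    (hsol : Group.IsSolvable (AutPlus Λ)) {T : Set X} (hT : IsLine d T) :
    Group.IsSolvable (setStab G T) := by
  obtain ⟨f, hf⟩ := hT.1.exists_isCoordinate h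
  let N : Subgroup (setStab G T) := (orientedStab f T α).subgroupOf (setStab G T)
  have hcomm : ∀ a b : setStab G T, a * b * a⁻¹ * b⁻¹ ∈ N := fun a b =>
    Subgroup.mem_subgroupOf.2 (hA.commutator_mem_orientedStab hf a.2 b.2)
  have hN : N.Normal := ⟨fun n hn g => by
    have h1 := N.mul_mem (hcomm g n) hn
    rwa [inv_mul_cancel_right] at h1⟩
  rw [Group.isSolvable_iff_subgroup_quotient N]
  constructor
  · let ψ : N →* AutPlus Λ := (α.comp (setStab G T).subtype).comp N.subtype
    have hker : Group.IsSolvable ψ.ker := Group.isSolvable_of_comm fun a b =>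
      Subtype.ext (Subtype.ext (Subtype.ext
        (hA.commute_of_map_eq_one h (isLine_nonempty h hT) hf
          (Subgroup.mem_subgroupOf.1 a.1.2) (Subgroup.mem_subgroupOf.1 b.1.2) a.2 b.2)))
    exact Group.isSolvable_of_ker_le_range ψ.ker.subtype ψ (by simp)
  · refine Group.isSolvable_of_comm fun a b => ?_
    induction a using QuotientGroup.induction_on with | H a => ?_
    induction b using QuotientGroup.induction_on with | H b => ?_
    rw [← QuotientGroup.mk_mul, ← QuotientGroup.mk_mul, eq_comm, QuotientGroup.eq]
    simpa [mul_assoc] using hcomm a⁻¹ b⁻¹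

theorem mem_orientedStab_of_preservesOrientation (hA : IsFreeAffineAction d α) {T : Set X}
    {f : X → Λ} (hf : IsCoordinate d T f) {g : G} (hg : PreservesOrientation d T g) :
    g ∈ orientedStab f T α := by
  obtain ⟨hgT, f', hf', hmono⟩ := hg
  refine ⟨hgT, ?_⟩
  have hmem := fun {z} (hz : z ∈ T) => smul_mem_of_mem_setStab hgT hz
  have key : ∀ x ∈ T, ∀ y ∈ T, f' (g • x) - f' (g • y) = (α g : Λ ≃o Λ) (f' x - f' y) := by
    rcases hA.sub_eq_or_of_mapsTo hf' (fun x hx => hmem hx) with h1 | h1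
    · exact h1
    -- A map both weakly increasing and sign-reversing forces f' to be constant on T, where the two
    -- signs agree.
    · have h2 : ∀ x ∈ T, ∀ y ∈ T, f' x ≤ f' y → f' x = f' y := by
        intro x hx y hy hxy
        have h3 := hmono x hx y hy hxy
        rw [← sub_nonpos, h1 x hx y hy, ← AutPlus.map_zero (α g), OrderIso.le_iff_le] at h3
        exact le_antisymm hxy (by simpa using h3)
      intro x hx y hy
      have h3 : f' x = f' y := by
        rcases le_total (f' x) (f' y) with h4 | h4
        · exact h2 x hx y hy h4
        · exact (h2 y hy x hx h4).symm
      rw [h1 x hx y hy, h3]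
  intro x hx y hy
  rw [one_smul]
  rcases hf.sub_eq_or hf' with h1 | h1
  · rw [h1 _ (hmem hx) _ (hmem hy), key x hx y hy, h1 x hx y hy]
  · rw [h1 _ (hmem hx) _ (hmem hy), key y hy x hx, h1 x hx y hy]

theorem mem_orientedStab_of_not_interchangesEnds (hA : IsFreeAffineAction d α) {T : Set X}
    {f : X → Λ} (hf : IsCoordinate d T f) {g : G} (hgT : g ∈ setStab G T)
    (hg : ¬ InterchangesEnds d T g) : g ∈ orientedStab f T α := by
  refine ⟨hgT, fun x hx y hy => ?_⟩
  rw [one_smul]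
  rcases T.subsingleton_or_nontrivial with hs | hn
  · rw [hs hx hy, sub_self, sub_self, AutPlus.map_zero]
  · rcases hA.sub_eq_or_of_mapsTo hf (fun x hx => smul_mem_of_mem_setStab hgT hx) with h1 | h1
    · exact h1 x hx y hy
    · refine absurd ⟨hn, hgT, f, hf, fun a ha b hb hab => ?_⟩ hg
      rw [← sub_nonpos, h1 b hb a ha, ← AutPlus.map_zero (α g), OrderIso.le_iff_le]
      exact sub_nonpos.2 hab

end IsFreeAffineAction

end Stabilisers

/-! ### Unipotent actions on filtered abelian groups -/

section Unipotent

open scoped commutatorElement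

variable {K : Type v} [Group K] {W : Type u} [AddCommGroup W]

theorem filtration_map_mem {F : ℕ → AddSubgroup W} (hanti : Antitone F)
    {ρ : K →* AddMonoid.End W} (hρF : ∀ k i, ∀ v ∈ F i, ρ k v - v ∈ F (i + 1)) (k : K) {i : ℕ}
    {v : W} (hv : v ∈ F i) : ρ k v ∈ F i := by
  have := add_mem (hanti (Nat.le_succ i) (hρF k i v hv)) hv
  rwa [sub_add_cancel] at this

theorem end_mul_apply (ρ : K →* AddMonoid.End W) (a b : K) (v : W) :
    ρ (a * b) v = ρ a (ρ b v) := by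
  rw [map_mul]
  rfl

theorem end_one_apply (ρ : K →* AddMonoid.End W) (v : W) : ρ 1 v = v := by
  rw [map_one]
  rfl

/-- The elements moving each step of a filtration at least `n + 1` steps down. -/
def unipotentSeries {F : ℕ → AddSubgroup W} (hanti : Antitone F) {ρ : K →* AddMonoid.End W}
    (hρF : ∀ k i, ∀ v ∈ F i, ρ k v - v ∈ F (i + 1)) (n : ℕ) : Subgroup K where
  carrier := {k | ∀ i, ∀ v ∈ F i, ρ k v - v ∈ F (i + n + 1)}
  one_mem' := fun i v _ => by
    rw [end_one_apply, sub_self]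
    exact zero_mem _
  mul_mem' := fun {a b} ha hb i v hv => by
    have h1 := ha i _ (filtration_map_mem hanti hρF b hv)
    have h2 := add_mem h1 (hb i v hv)
    rwa [sub_add_sub_cancel, ← end_mul_apply] at h2
  inv_mem' := fun {a} ha i v hv => by
    have h1 := ha i _ (filtration_map_mem hanti hρF a⁻¹ hv)
    rw [← end_mul_apply, mul_inv_cancel, end_one_apply] at h1
    simpa using neg_mem h1

/-- A group acting faithfully and unipotently on a filtered abelian group is nilpotent. -/
theorem isNilpotent_of_filtration {F : ℕ → AddSubgroup W} (hanti : Antitone F)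
    {ρ : K →* AddMonoid.End W} (hρF : ∀ k i, ∀ v ∈ F i, ρ k v - v ∈ F (i + 1))
    (h0 : F 0 = ⊤) {m : ℕ} (hm : F m = ⊥) (hinj : Function.Injective ρ) :
    Group.IsNilpotent K := by
  rw [Subgroup.nilpotent_iff_finite_descending_central_series]
  refine ⟨m, unipotentSeries hanti hρF, ⟨?_, ?_⟩, ?_⟩
  · exact Subgroup.eq_top_iff' _ |>.2 fun k i v hv => hρF k i v hv
  · intro x n hx g i v hv
    -- With u = x⁻¹g⁻¹v, the difference [x, g]v − v is xgu − gxu = (x−1)(g−1)u − (g−1)(x−1)u. Both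
    -- terms drop n + 2 steps: n + 1 from x and one from g.
    have hu := filtration_map_mem hanti hρF x⁻¹ (filtration_map_mem hanti hρF g⁻¹ hv)
    rw [← end_mul_apply] at hu
    obtain ⟨u, hudef⟩ : ∃ u, ρ (x⁻¹ * g⁻¹) v = u := ⟨_, rfl⟩
    rw [hudef] at hu
    have e1 : v = ρ g (ρ x u) := by
      rw [← hudef, ← end_mul_apply, ← end_mul_apply, mul_assoc, mul_inv_cancel_left,
        mul_inv_cancel, end_one_apply]
    have e2 : ρ ⁅x, g⁆ v = ρ x (ρ g u) := by
      rw [← hudef, ← end_mul_apply, ← end_mul_apply, commutatorElement_def, mul_assoc (x * g)]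
    rw [e2, e1]
    have h1 := hx (i + 1) _ (hρF g i u hu)
    have h2 := hρF g (i + n + 1) _ (hx i u hu)
    rw [show i + 1 + n + 1 = i + (n + 1) + 1 by ring] at h1
    rw [show i + n + 1 + 1 = i + (n + 1) + 1 by ring] at h2
    have h3 := sub_mem h1 h2
    rw [map_sub, map_sub] at h3
    convert h3 using 1
    abel
  · refine (Subgroup.eq_bot_iff_forall _).2 fun k hk => hinj ?_
    ext v
    have h1 := hk 0 v (h0 ▸ AddSubgroup.mem_top v)
    have h2 := hanti (show m ≤ 0 + m + 1 by omega) h1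
    rw [hm, AddSubgroup.mem_bot, sub_eq_zero] at h2
    rw [h2, end_one_apply]

end Unipotent

/-! ### Order automorphisms of lexicographic ℤⁿ -/

section ZLex

variable {n : ℕ}

/-- The convex subgroup of `ℤⁿ` of the vectors whose first `i` coordinates vanish. -/
def ZLex.tail (n i : ℕ) : AddSubgroup (ZLex n) where
  carrier := {v | ∀ j : Fin n, (j : ℕ) < i → v j = 0}
  zero_mem' := fun _ _ => rfl
  add_mem' := fun {a b} ha hb j hj => by
    change a j + b j = 0
    rw [ha j hj, hb j hj, add_zero]
  neg_mem' := fun {a} ha j hj => by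
    change -a j = 0
    rw [ha j hj, neg_zero]

theorem ZLex.mem_tail {i : ℕ} {v : ZLex n} :
    v ∈ ZLex.tail n i ↔ ∀ j : Fin n, (j : ℕ) < i → v j = 0 := Iff.rfl

theorem ZLex.lt_iff {a b : ZLex n} : a < b ↔ ∃ k, (∀ j < k, a j = b j) ∧ a k < b k := Iff.rfl

theorem ZLex.tail_zero : ZLex.tail n 0 = ⊤ :=
  (AddSubgroup.eq_top_iff' _).2 fun _ j hj => absurd hj (Nat.not_lt_zero j)

theorem ZLex.tail_eq_bot {i : ℕ} (hi : n ≤ i) : ZLex.tail n i = ⊥ :=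
  (AddSubgroup.eq_bot_iff_forall _).2 fun _ hv => funext fun j => hv j (j.2.trans_le hi)

theorem ZLex.tail_antitone : Antitone (ZLex.tail n) :=
  fun _ _ hij _ hv k hk => hv k (hk.trans_le hij)

theorem ZLex.mem_tail_of_pos_le {i : ℕ} {b c : ZLex n} (hb : 0 < b) (hbc : b ≤ c)
    (hc : c ∈ ZLex.tail n i) : b ∈ ZLex.tail n i := by
  obtain ⟨l, hl, hbl⟩ := ZLex.lt_iff.1 hb
  by_contra hbi
  rw [ZLex.mem_tail] at hbi
  push Not at hbi
  obtain ⟨j, hj, hbj⟩ := hbi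
  have hlj : l ≤ j := by
    by_contra hlj
    exact hbj (hl j (not_le.1 hlj)).symm
  have hli : (l : ℕ) < i := lt_of_le_of_lt hlj hj
  refine absurd hbc (not_le.2 (ZLex.lt_iff.2 ⟨l, fun k hk => ?_, ?_⟩))
  · rw [hc k (lt_trans hk hli), ← hl k hk]
    rfl
  · rw [hc l hli]
    exact hbl

theorem ZLex.tail_convex {i : ℕ} {a b c : ZLex n} (hab : a ≤ b) (hbc : b ≤ c)
    (ha : a ∈ ZLex.tail n i) (hc : c ∈ ZLex.tail n i) : b ∈ ZLex.tail n i := by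
  rcases lt_trichotomy b 0 with h | h | h
  · rw [← neg_mem_iff] at ha ⊢
    exact ZLex.mem_tail_of_pos_le (neg_pos.2 h) (neg_le_neg hab) ha
  · rw [h]
    exact zero_mem _
  · exact ZLex.mem_tail_of_pos_le h hbc hc

/-- The standard basis vector. -/
def ZLex.basis (i : Fin n) : ZLex n := toLex (Pi.single i 1)

theorem ZLex.basis_self (i : Fin n) : ZLex.basis i i = 1 := Pi.single_eq_same i 1

theorem ZLex.basis_ne {i j : Fin n} (h : j ≠ i) : ZLex.basis i j = 0 := Pi.single_eq_of_ne h 1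

theorem ZLex.basis_pos (i : Fin n) : 0 < ZLex.basis i :=
  ZLex.lt_iff.2 ⟨i, fun _ hj => (ZLex.basis_ne hj.ne).symm, by
    rw [ZLex.basis_self]
    exact Int.one_pos⟩

theorem ZLex.exists_basis_le (i : Fin n) {v : ZLex n} (hv : 0 < v)
    (hvi : v ∉ ZLex.tail n (i + 1)) : ∃ w ∈ ZLex.tail n (i + 1), ZLex.basis i ≤ v + w := by
  -- Adding w erases the coordinates of v after i. The leading entry of v is a positive integer at a
  -- place l ≤ i, hence at least 1.
  let w : ZLex n := toLex fun j => if j ≤ i then 0 else -v j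
  have hw1 : ∀ j ≤ i, (v + w) j = v j := fun j hj => by
    change v j + (if j ≤ i then 0 else -v j) = v j
    rw [if_pos hj, add_zero]
  have hw2 : ∀ j, i < j → (v + w) j = 0 := fun j hj => by
    change v j + (if j ≤ i then 0 else -v j) = 0
    rw [if_neg (not_le.2 hj), add_neg_cancel]
  refine ⟨w, fun j hj => if_pos (Fin.le_def.2 (Nat.lt_succ_iff.1 hj)), ?_⟩
  by_contra hlt
  obtain ⟨k, hk, hkl⟩ := ZLex.lt_iff.1 (not_le.1 hlt)
  obtain ⟨l, hl, hvl⟩ := ZLex.lt_iff.1 hv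
  change (0 : ℤ) < v l at hvl
  have hl' : ∀ j < l, v j = 0 := fun j hj => (hl j hj).symm
  have hli : l ≤ i := by
    by_contra hli
    exact hvi fun j hj => hl' j (lt_of_le_of_lt (Nat.lt_succ_iff.1 hj) (not_le.1 hli))
  rcases lt_trichotomy k l with h | h | h
  · rw [hw1 k (h.le.trans hli), hl' k h, ZLex.basis_ne (h.trans_le hli).ne] at hkl
    exact lt_irrefl _ hkl
  · subst h
    rw [hw1 k hli] at hkl
    rcases hli.lt_or_eq with h1 | h1
    · rw [ZLex.basis_ne h1.ne] at hkl
      omega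
    · rw [h1, ZLex.basis_self] at hkl
      rw [h1] at hvl
      omega
  · have h1 := hk l h
    rw [hw1 l hli] at h1
    rcases hli.lt_or_eq with h2 | h2
    · rw [ZLex.basis_ne h2.ne] at h1
      omega
    · subst h2
      rw [hw2 k h, ZLex.basis_ne h.ne'] at hkl
      exact lt_irrefl _ hkl

theorem ZLex.sub_smul_basis_mem {i : Fin n} {v : ZLex n} (hv : v ∈ ZLex.tail n i) :
    v - v i • ZLex.basis i ∈ ZLex.tail n (i + 1) := by
  intro j hj
  change v j - v i * ZLex.basis i j = 0
  rcases (Fin.le_def.2 (Nat.lt_succ_iff.1 hj)).lt_or_eq with h | h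
  · rw [hv j h, ZLex.basis_ne h.ne, mul_zero, sub_zero]
  · rw [h, ZLex.basis_self, mul_one, sub_self]

theorem smul_sub_add_sub_sub {A : Type u} [AddCommGroup A] (m : ℤ) (a b c v : A) :
    m • (a - b) + (c - m • a) - (v - m • b) = c - v := by
  rw [smul_sub]
  abel

/-- Modulo the next convex subgroup, e_i is the least positive class, so φ and φ⁻¹ each send it to
something no smaller. By convexity φ fixes it modulo that subgroup, and v differs from a multiple of
e_i by an element of it. -/
theorem ZLex.sub_mem_tail_succ_of {i : Fin n}
    (hi : ∀ φ : AutPlus (ZLex n), ∀ v ∈ ZLex.tail n (i + 1), φ.1 v ∈ ZLex.tail n (i + 1))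
    (φ : AutPlus (ZLex n)) {v : ZLex n} (hv : v ∈ ZLex.tail n i) :
    φ.1 v - v ∈ ZLex.tail n (i + 1) := by
  have hnot : ∀ ψ : AutPlus (ZLex n), ψ.1 (ZLex.basis i) ∉ ZLex.tail n (i + 1) := by
    intro ψ h
    have h1 := hi ψ⁻¹ _ h
    have h2 : (ψ⁻¹).1 (ψ.1 (ZLex.basis i)) = ZLex.basis i := ψ.1.symm_apply_apply _
    rw [h2] at h1
    have h3 := h1 i (Nat.lt_succ_self _)
    rw [ZLex.basis_self] at h3
    exact one_ne_zero h3
  have hpos : ∀ ψ : AutPlus (ZLex n), 0 < ψ.1 (ZLex.basis i) := fun ψ =>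
    AutPlus.map_pos ψ (ZLex.basis_pos i)
  obtain ⟨w, hw, hle⟩ := ZLex.exists_basis_le i (hpos φ) (hnot φ)
  obtain ⟨w', hw', hle'⟩ := ZLex.exists_basis_le i (hpos φ⁻¹) (hnot φ⁻¹)
  have hle2 : φ.1 (ZLex.basis i) ≤ ZLex.basis i + φ.1 w' := by
    have h1 := φ.1.monotone hle'
    rw [AutPlus.map_add] at h1
    have h2 : φ.1 ((φ⁻¹).1 (ZLex.basis i)) = ZLex.basis i := φ.1.apply_symm_apply _
    rwa [h2] at h1
  have hbasis : φ.1 (ZLex.basis i) - ZLex.basis i ∈ ZLex.tail n (i + 1) :=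
    ZLex.tail_convex (a := -w) (c := φ.1 w') (neg_le_sub_iff_le_add.2 hle)
      (sub_le_iff_le_add'.2 hle2) (neg_mem hw) (hi φ _ hw')
  have hrest := ZLex.sub_smul_basis_mem hv
  have h3 := sub_mem (add_mem (zsmul_mem hbasis (v i)) (hi φ _ hrest)) hrest
  rw [AutPlus.map_sub, show φ.1 (v i • ZLex.basis i) = v i • φ.1 (ZLex.basis i) from
    map_zsmul (AutPlus.toAddMonoidHom φ) _ _] at h3
  rw [← smul_sub_add_sub_sub (v i) (φ.1 (ZLex.basis i)) (ZLex.basis i) (φ.1 v) v]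
  exact h3

/-- Order-preserving automorphisms of `ℤⁿ` are unipotent. -/
theorem ZLex.sub_mem_tail_succ (φ : AutPlus (ZLex n)) (i : ℕ) {v : ZLex n}
    (hv : v ∈ ZLex.tail n i) : φ.1 v - v ∈ ZLex.tail n (i + 1) := by
  -- Stability of the convex subgroups is proved upwards from the trivial one, since each step needs
  -- it one level below.
  have hstable : ∀ j ≤ n, ∀ φ : AutPlus (ZLex n), ∀ v ∈ ZLex.tail n (n - j),
      φ.1 v ∈ ZLex.tail n (n - j) := by
    intro j
    induction j with
    | zero =>
      intro _ φ v hv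
      rw [Nat.sub_zero, ZLex.tail_eq_bot le_rfl, AddSubgroup.mem_bot] at hv ⊢
      rw [hv, AutPlus.map_zero]
    | succ j ih =>
      intro hj φ v hv
      have hlt : n - (j + 1) < n := by omega
      have hs : n - j = (⟨n - (j + 1), hlt⟩ : Fin n).1 + 1 := by
        change n - j = n - (j + 1) + 1
        omega
      have h1 := ZLex.sub_mem_tail_succ_of (i := ⟨n - (j + 1), hlt⟩)
        (by rw [← hs]; exact ih (by omega)) φ hv
      have h2 := add_mem (ZLex.tail_antitone (Nat.le_succ _) h1) hv
      rwa [sub_add_cancel] at h2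
  rcases lt_or_ge i n with hi | hi
  · refine ZLex.sub_mem_tail_succ_of (i := ⟨i, hi⟩) ?_ φ hv
    have := hstable (n - (i + 1)) (by omega)
    rwa [show n - (n - (i + 1)) = i + 1 by omega] at this
  · rw [ZLex.tail_eq_bot hi, AddSubgroup.mem_bot] at hv
    rw [hv, AutPlus.map_zero, sub_zero]
    exact zero_mem _

end ZLex

/-! ### Nilpotency of oriented stabilisers, and maximal subgroups -/

section Main

open scoped Pointwise

variable {Λ : Type u} [AddCommGroup Λ] [LinearOrder Λ] [IsOrderedAddMonoid Λ]
  {G : Type v} [Group G] {X : Type w} [MulAction G X] {d : X → X → Λ} {α : G →* AutPlus Λ}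

/-- The linear representation on `ℤ × Λ` of the affine action of `orientedStab` on `Λ`. -/
def affineRep (f : X → Λ) (T : Set X) (α : G →* AutPlus Λ) {x : X} (hx : x ∈ T) :
    orientedStab f T α →* AddMonoid.End (ℤ × Λ) where
  toFun k := AddMonoidHom.mk' (fun p => (p.1, (α k : Λ ≃o Λ) p.2 +
      p.1 • (f ((k : G) • x) - (α k : Λ ≃o Λ) (f x)))) (by
    rintro ⟨a, p⟩ ⟨b, q⟩
    refine Prod.ext rfl ?_
    change (α k : Λ ≃o Λ) (p + q) + (a + b) • _ = (α k : Λ ≃o Λ) p + a • _ +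
      ((α k : Λ ≃o Λ) q + b • _)
    rw [AutPlus.map_add, add_smul]
    abel)
  map_one' := by
    ext p
    all_goals simp
    all_goals rfl
  map_mul' k l := by
    refine AddMonoidHom.ext fun p => Prod.ext rfl ?_
    have h1 := k.2.2.one_apply (smul_mem_of_mem_setStab l.2.1 hx) hx
    have h2 : ((α (k * l : G) : AutPlus Λ) : Λ ≃o Λ) = (α k : Λ ≃o Λ) * (α l : Λ ≃o Λ) := by
      rw [map_mul]
      rfl
    change (α (k * l : G) : Λ ≃o Λ) p.2 + p.1 • (f ((k * l : G) • x) - (α (k * l : G)).1 (f x)) =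
      (α k : Λ ≃o Λ) ((α l : Λ ≃o Λ) p.2 + p.1 • (f ((l : G) • x) - (α l).1 (f x))) +
        p.1 • (f ((k : G) • x) - (α k).1 (f x))
    rw [AutPlus.map_sub] at h1
    rw [h2, RelIso.mul_apply, RelIso.mul_apply, mul_smul, AutPlus.map_add, add_assoc,
      show (α k : Λ ≃o Λ) (p.1 • (f ((l : G) • x) - (α l).1 (f x))) =
        p.1 • (α k : Λ ≃o Λ) (f ((l : G) • x) - (α l).1 (f x)) from
        map_zsmul (AutPlus.toAddMonoidHom (α k)) _ _, ← smul_add, AutPlus.map_sub]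
    congr 2
    grind

theorem affineRep_apply (f : X → Λ) (T : Set X) (α : G →* AutPlus Λ) {x : X} (hx : x ∈ T)
    (k : orientedStab f T α) (p : ℤ × Λ) :
    affineRep f T α hx k p = (p.1, (α k : Λ ≃o Λ) p.2 +
      p.1 • (f ((k : G) • x) - (α k : Λ ≃o Λ) (f x))) := rfl

theorem IsFreeAffineAction.affineRep_injective (hA : IsFreeAffineAction d α)
    (h : IsLambdaTree d) {f : X → Λ} {T : Set X} (hf : IsCoordinate d T f) {x : X} (hx : x ∈ T) :
    Function.Injective (affineRep f T α hx) := by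
  refine (injective_iff_map_eq_one _).2 fun k hk => Subtype.ext ?_
  -- On the slice with first entry 1 the representation is the affine action, sending f(x) to f(kx).
  -- An element of the kernel thus fixes x.
  have h1 := congrArg Prod.snd (DFunLike.congr_fun hk (1, f x))
  rw [affineRep_apply] at h1
  change (α k : Λ ≃o Λ) (f x) + (1 : ℤ) • (f ((k : G) • x) - (α k : Λ ≃o Λ) (f x)) = f x at h1
  rw [one_smul, add_sub_cancel] at h1
  have h2 := hf _ (smul_mem_of_mem_setStab k.2.1 hx) _ hx
  rw [h1, sub_self, abs_zero, h.eq_zero_iff] at h2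
  exact hA.eq_one_of_smul_eq h2

/-- The filtration of `ℤ × ℤⁿ` by convex subgroups. -/
def affineFiltration (n : ℕ) : ℕ → AddSubgroup (ℤ × ZLex n)
  | 0 => ⊤
  | i + 1 => (⊥ : AddSubgroup ℤ).prod (ZLex.tail n i)

theorem isNilpotent_orientedStab {n : ℕ} {d : X → X → ZLex n} {α : G →* AutPlus (ZLex n)}
    (hA : IsFreeAffineAction d α) (h : IsLambdaTree d) {f : X → ZLex n} {T : Set X}
    (hf : IsCoordinate d T f) (hT : T.Nonempty) : Group.IsNilpotent (orientedStab f T α) := by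
  obtain ⟨x, hx⟩ := hT
  -- One step more than ℤⁿ requires: the first removes the ℤ factor carrying the translation part.
  refine isNilpotent_of_filtration (F := affineFiltration n) (m := n + 1) ?_ ?_ rfl ?_
    (hA.affineRep_injective h hf hx)
  · refine antitone_nat_of_succ_le fun i => ?_
    cases i with
    | zero => exact le_top
    | succ i => exact AddSubgroup.prod_mono le_rfl (ZLex.tail_antitone (Nat.le_succ i))
  · rintro k i ⟨a, v⟩ hv
    rw [affineRep_apply]
    cases i with
    | zero =>
      refine AddSubgroup.mem_prod.2 ⟨?_, ?_⟩
      · simp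
      · rw [ZLex.tail_zero]
        exact AddSubgroup.mem_top _
    | succ i =>
      obtain ⟨ha, hv⟩ := AddSubgroup.mem_prod.1 hv
      obtain rfl : a = 0 := ha
      refine AddSubgroup.mem_prod.2 ⟨?_, ?_⟩
      · simp
      · simpa using ZLex.sub_mem_tail_succ (α k) i hv
  · change (⊥ : AddSubgroup ℤ).prod (ZLex.tail n n) = ⊥
    rw [ZLex.tail_eq_bot le_rfl]
    exact AddSubgroup.bot_prod_bot

theorem isNilpotent_of_le {H K : Subgroup G} (hHK : H ≤ K) (hK : Group.IsNilpotent K) :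
    Group.IsNilpotent H := by
  have := Subgroup.isNilpotent (H.subgroupOf K)
  exact Group.nilpotent_of_mulEquiv (Subgroup.subgroupOfEquivOfLe hHK)

namespace IsFreeAffineAction

variable {P : ∀ (K : Type v) [Group K], Prop}

/-- If line stabilisers are `P` and non-trivial `P` subgroups stabilise lines, then the
non-trivial line stabilisers are the maximal `P` subgroups. -/
theorem isLineStabiliser_iff (hA : IsFreeAffineAction d α) (h : IsLambdaTree d)
    (hstab : ∀ T, IsLine d T → P (setStab G T))
    (hline : ∀ H : Subgroup G, H ≠ ⊥ → P H → StabilisesLine d H) [Nontrivial G]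
    (H : Subgroup G) : (H ≠ ⊥ ∧ IsLineStabiliser d H) ↔ IsMaximalP P H := by
  constructor
  · rintro ⟨hH, T, hT, rfl⟩
    refine ⟨hstab T hT, fun K hK hle => ?_⟩
    obtain ⟨T', hT', hKT'⟩ := hline K (fun h' => hH (le_bot_iff.1 (h' ▸ hle))) hK
    obtain ⟨a, ha, ha1⟩ := (setStab G T).bot_or_exists_ne_one.resolve_left hH
    rwa [hA.eq_of_mem_setStab h hT hT' ha1 ha (hKT' (hle ha))]
  · intro hH
    -- The trivial subgroup is not maximal, since any g ≠ 1 lies in a line stabiliser.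
    have hne : H ≠ ⊥ := by
      rintro rfl
      obtain ⟨g, hg⟩ := exists_ne (1 : G)
      obtain ⟨T, hT, hgT⟩ := hA.exists_line h hg
      exact hg (hH.2 (hstab T hT) bot_le (mem_setStab.2 hgT))
    obtain ⟨T, hT, hHT⟩ := hline H hne hH.1
    exact ⟨hne, T, hT, hHT.antisymm (hH.2 (hstab T hT) hHT)⟩

/-- The maximal P subgroup through x ≠ 1 is the stabiliser of the unique line of x. Malnormality is
`mem_setStab_of_conj` applied to a common element of M and gMg⁻¹. -/
theorem isCSP (hA : IsFreeAffineAction d α) (h : IsLambdaTree d)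
    (hstab : ∀ T, IsLine d T → P (setStab G T))
    (hline : ∀ H : Subgroup G, H ≠ ⊥ → P H → StabilisesLine d H) : IsCSP P G := by
  rcases subsingleton_or_nontrivial G with hG | hG
  · exact ⟨fun x hx => absurd (Subsingleton.elim x 1) hx, fun M _ g hg =>
      absurd (Subsingleton.elim g 1 ▸ M.one_mem) hg⟩
  have hiff := hA.isLineStabiliser_iff h hstab hline
  constructor
  · intro x hx
    obtain ⟨T, hT, hxT⟩ := hA.exists_line h hx
    have hxT := mem_setStab.2 hxT
    refine ⟨setStab G T, ⟨(hiff _).1 ⟨fun h' => hx ?_, T, hT, rfl⟩, hxT⟩, ?_⟩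
    · rwa [h', Subgroup.mem_bot] at hxT
    · rintro M ⟨hM, hxM⟩
      obtain ⟨-, T', hT', rfl⟩ := (hiff M).2 hM
      rw [hA.eq_of_mem_setStab h hT hT' hx hxT hxM]
  · intro M hM g hg
    obtain ⟨-, T, hT, rfl⟩ := (hiff M).2 hM
    refine (Subgroup.eq_bot_iff_forall _).2 fun x hx => ?_
    obtain ⟨hx1, y, hy, rfl⟩ := hx
    by_contra hne
    refine hg (hA.mem_setStab_of_conj h hT hne hx1 ?_)
    simpa [mul_assoc] using hy

end IsFreeAffineAction

end Main
end AffineTree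

theorem mainTheorem10 :
    -- general `Λ`
    (∀ (Λ : Type u) [AddCommGroup Λ] [LinearOrder Λ] [IsOrderedAddMonoid Λ]
      (G : Type v) [Group G] (X : Type w) [MulAction G X]
      (d : X → X → Λ) (α : G →* AffineTree.AutPlus Λ),
      AffineTree.IsLambdaTree d → AffineTree.IsFreeAffineAction d α →
        -- a non-trivial subnormal abelian subgroup forces `G` to stabilise a line
        (∀ H : Subgroup G, H ≠ ⊥ → H.IsSubnormal → (∀ a ∈ H, ∀ b ∈ H, a * b = b * a) →
          AffineTree.StabilisesLine d (⊤ : Subgroup G)) ∧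
        (Group.IsSolvable (AffineTree.AutPlus Λ) →
          -- subgroups stabilising a line are soluble
          (∀ H : Subgroup G, AffineTree.StabilisesLine d H → AffineTree.Soluble H) ∧
          -- the non-trivial line stabilisers are precisely the maximal soluble subgroups
          (Nontrivial G → ∀ H : Subgroup G,
            (H ≠ ⊥ ∧ AffineTree.IsLineStabiliser d H) ↔
              AffineTree.IsMaximalP AffineTree.Soluble H))) ∧
    -- `ATF(Λ)` groups are CSS when `Aut⁺(Λ)` is soluble
    (∀ (Λ : Type u) [AddCommGroup Λ] [LinearOrder Λ] [IsOrderedAddMonoid Λ]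
      (G : Type v) [Group G],
      Group.IsSolvable (AffineTree.AutPlus Λ) → AffineTree.IsATF.{u, v, w} Λ G →
        AffineTree.IsCSS G) ∧
    -- `Λ = ℤⁿ`
    (∀ (n : ℕ) (G : Type v) [Group G] (X : Type w) [MulAction G X]
      (d : X → X → AffineTree.ZLex n) (α : G →* AffineTree.AutPlus (AffineTree.ZLex n)),
      AffineTree.IsLambdaTree d → AffineTree.IsFreeAffineAction d α →
        -- a subgroup stabilising a line and preserving its orientation is nilpotent
        (∀ (H : Subgroup G) (T : Set X), AffineTree.IsLine d T →
          (∀ h ∈ H, AffineTree.PreservesOrientation d T h) → AffineTree.Nilpotent H) ∧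
        ((∀ (T : Set X) (g : G), AffineTree.IsLine d T → ¬ AffineTree.InterchangesEnds d T g) →
          -- the non-trivial line stabilisers are precisely the maximal nilpotent subgroups
          (Nontrivial G → ∀ H : Subgroup G,
            (H ≠ ⊥ ∧ AffineTree.IsLineStabiliser d H) ↔
              AffineTree.IsMaximalP AffineTree.Nilpotent H) ∧
          AffineTree.IsCSN G)) := by
  refine ⟨?_, ?_, ?_⟩
  · intro Λ _ _ _ G _ X _ d α h hA
    refine ⟨fun H hH hsub hcomm => hA.stabilisesLine_top_of_isSubnormal h hsub hH
      (hA.exists_line_of_comm h hH hcomm), fun hsol => ⟨fun H ⟨T, hT, hHT⟩ => ?_, fun _ H => ?_⟩⟩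
    · have := hA.isSolvable_setStab h hsol hT
      exact Group.isSolvable_of_isSolvable_injective (Subgroup.inclusion_injective hHT)
    · exact hA.isLineStabiliser_iff h (fun T hT => hA.isSolvable_setStab h hsol hT)
        (fun H hH hP => hA.stabilisesLine_of_soluble h hH hP) H
  · rintro Λ _ _ _ G _ hsol ⟨X, _, d, α, h, hA⟩
    exact hA.isCSP h (fun T hT => hA.isSolvable_setStab h hsol hT)
      (fun H hH hP => hA.stabilisesLine_of_soluble h hH hP)
  · intro n G _ X _ d α h hA
    refine ⟨fun H T hT hH => ?_, fun hno => ?_⟩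
    · obtain ⟨f, hf⟩ := hT.1.exists_isCoordinate h
      exact AffineTree.isNilpotent_of_le
        (fun g hg => hA.mem_orientedStab_of_preservesOrientation hf (hH g hg))
        (AffineTree.isNilpotent_orientedStab hA h hf (AffineTree.isLine_nonempty h hT))
    · have hstab : ∀ T, AffineTree.IsLine d T →
          AffineTree.Nilpotent (AffineTree.setStab G T) := by
        intro T hT
        obtain ⟨f, hf⟩ := hT.1.exists_isCoordinate h
        exact AffineTree.isNilpotent_of_le
          (fun g hg => hA.mem_orientedStab_of_not_interchangesEnds hf hg (hno T g hT))
          (AffineTree.isNilpotent_orientedStab hA h hf (AffineTree.isLine_nonempty h hT))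
      have hline : ∀ H : Subgroup G, H ≠ ⊥ → AffineTree.Nilpotent H →
          AffineTree.StabilisesLine d H := fun H hH hP =>
        hA.stabilisesLine_of_soluble h hH (@IsNilpotent.to_isSolvable _ _ hP)
      exact ⟨fun _ H => hA.isLineStabiliser_iff h hstab hline H, hA.isCSP h hstab hline⟩
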